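/- **Conventions.** For a finite real matrix $S=(S_{x,y})$ put $\gamma(S)=\sum_{x,y}S_{x,y}$ and $\|S\|_1=\sum_{x,y}|S_{x,y}|$. For integers $k,n\ge 1$ let $\mathcal K(k,n)$ be the set of non-negative $k\times n$ matrices with every row sum equal to $n/k$ and every column sum equal to $1$. The $k$-shape of an $n\times n$ matrix $S$ is $C(S,k)=\{MSM^{T}: M\in\mathcal K(k,n)\}\subset\mathbb R^{k\times k}$. For a finite simple graph $G$ with at least one edge and adjacency matrix $A_G$, put $C_0(G,k)=\|A_G\|_1^{-1}\,C(A_G,k)$. Let $(\Omega,\nu)$ be either $[0,1]$ with Lebesgue measure or the Cantor set $\mathcal C=\{0,1\}^{\mathbb N}$ with the product of the uniform measures on $\{0,1\}$. For a finite Borel measure $\mu$ on $\Omega^2$, the $k$-shape $C(\mu,k)$ is the closure in $\mathbb R^{k\times k}$ of the set of all matrices $\left(\int_{\Omega^2} f_i(x)f_j(y)\,d\mu(x,y)\right)_{i,j=1}^k$, where $f_1,\dots,f_k$ range over the non-negative Borel functions on $\Omega$ with $\sum_{i}f_i= 1$ everywhere and $\int_\Omega f_i\,d\nu=1/k$ for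 every $i$. The measure $\mu$ is symmetric if it is invariant under $(x,y)\mapsto(y,x)$; an s-graphon is a symmetric Borel probability measure on $[0,1]^2$. Sets of $k\times k$ matrices converge in the sense of the Hausdorff metric induced by the $\ell_1$ norm. A sequence $(G_i)$ of finite graphs, each with at least one edge, is s-convergent if for every $k\ge 1$ the sets $C_0(G_i,k)$ converge to a closed set, and its s-limit is $\mu$ if $C_0(G_i,k)\to C(\mu,k)$ for every $k\ge1$. A sequence $(S_i)$ of non-negative matrices is convergent if there is $c>0$ such that $\gamma(S_i)<c$ for all $i$ and, for every $k\ge 1$, the sets $C(S_i,k)$ converge to a closed subset of $[0,c]^{k\times k}$; its limit is $\mu$ if $C(S_i,k)\to C(\mu,k)$ for every $k\ge1$. **Theorem.** 1. For every s-graphon $\mu$ there is a sequence $(G_i)_{i\ge1}$ of finite simple graphs, each with at least one edge, that is s-convergent with s-limit $\mu$. 2. Let $\mu$ be a symmetric finite Borel measure on $[0,1]^2$, or on $\mathcal C^2$, and let $m$ be its total mass. Then there is a sequence $(S_i)_{i\ge1}$ of non-negative symmetric matrices with $\gamma(S_i)=m$ for every $i$ that is convergent with limit $\mu$. -/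

import Mathlib

open MeasureTheory Filter
open scoped Topology

noncomputable section

namespace ShapeLimit

/-- `γ(S)`: the sum of all entries of a matrix. -/
def entrySum {V : Type} [Fintype V] (S : Matrix V V ℝ) : ℝ := ∑ x, ∑ y, S x y

/-- The entrywise `ℓ¹` norm of a matrix. -/
def l1Norm {V : Type} [Fintype V] (S : Matrix V V ℝ) : ℝ := ∑ x, ∑ y, |S x y|

/-- `𝒦(k, n)` with `n = |V|`: the nonnegative `k × n` matrices all of whose row sums are `n / k`
and all of whose column sums are `1`. -/
def fractionalPartitions (k : ℕ) (V : Type) [Fintype V] : Set (Matrix (Fin k) V ℝ) :=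
  {M | (∀ i x, 0 ≤ M i x) ∧ (∀ i, ∑ x, M i x = (Fintype.card V : ℝ) / (k : ℝ)) ∧
    (∀ x, ∑ i, M i x = 1)}

/-- The `k`-shape `C(S, k) = {M S Mᵀ | M ∈ 𝒦(k, n)}` of an `n × n` matrix. -/
def matrixShape {V : Type} [Fintype V] (S : Matrix V V ℝ) (k : ℕ) :
    Set (Matrix (Fin k) (Fin k) ℝ) :=
  {X | ∃ M ∈ fractionalPartitions k V, X = M * S * M.transpose}

open Classical in
/-- The edge-number normalized `k`-shape `C₀(G, k) = ‖A_G‖₁⁻¹ C(A_G, k)` of a graph. -/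
def graphShape {V : Type} [Fintype V] (G : SimpleGraph V) (k : ℕ) :
    Set (Matrix (Fin k) (Fin k) ℝ) :=
  (fun X => (l1Norm (G.adjMatrix ℝ))⁻¹ • X) '' matrixShape (G.adjMatrix ℝ) k

/-- The families `f₁, …, f_k` of nonnegative measurable functions on `(Ω, ν)` whose sum is
(everywhere) the constant function `1` and each of which has integral `1 / k`. -/
def functionPartitions {Ω : Type} [MeasurableSpace Ω] (ν : Measure Ω) (k : ℕ) :
    Set (Fin k → Ω → ℝ) :=
  {f | (∀ i, Measurable (f i)) ∧ (∀ i x, 0 ≤ f i x) ∧ (∀ x, ∑ i, f i x = 1) ∧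
    (∀ i, ∫ x, f i x ∂ν = 1 / (k : ℝ))}

/-- The matrix `M(i, j) = ∫ f_i(x) f_j(y) dμ(x, y)`. -/
def momentMatrix {Ω : Type} [MeasurableSpace Ω] (μ : Measure (Ω × Ω)) {k : ℕ}
    (f : Fin k → Ω → ℝ) : Matrix (Fin k) (Fin k) ℝ :=
  Matrix.of fun i j => ∫ z, f i z.1 * f j z.2 ∂μ

/-- The `k`-shape `C(μ, k)` of a measure `μ` on `Ω × Ω`: the topological closure, in the space of
real `k × k` matrices, of the set of all matrices `M(f₁, …, f_k)`. -/
def measureShape {Ω : Type} [MeasurableSpace Ω] (ν : Measure Ω) (μ : Measure (Ω × Ω)) (k : ℕ) :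
    Set (Matrix (Fin k) (Fin k) ℝ) :=
  closure (momentMatrix μ '' functionPartitions ν k)

/-- A `k × k` matrix as a point of `ℝ^{k × k}` with the `ℓ¹` metric. -/
def toL1 {k : ℕ} (X : Matrix (Fin k) (Fin k) ℝ) : PiLp 1 (fun _ : Fin k × Fin k => ℝ) :=
  WithLp.toLp 1 fun p => X p.1 p.2

/-- Convergence of sets of `k × k` matrices in the Hausdorff metric induced by the `ℓ¹` norm. -/
def HausdorffTendsto {k : ℕ} (A : ℕ → Set (Matrix (Fin k) (Fin k) ℝ))
    (K : Set (Matrix (Fin k) (Fin k) ℝ)) : Prop :=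
  Tendsto (fun i => Metric.hausdorffEDist (toL1 '' A i) (toL1 '' K)) atTop (𝓝 0)

/-- Convergence of a sequence of matrices: the entry sums are bounded by a constant `c`
and every shape converges to a closed subset of `[0, c]^{k × k}`. -/
def MatrixConvergent {n : ℕ → ℕ} (S : ∀ i, Matrix (Fin (n i)) (Fin (n i)) ℝ) : Prop :=
  ∃ c : ℝ, 0 < c ∧ (∀ i, entrySum (S i) < c) ∧ ∀ k : ℕ, 0 < k →
    ∃ K : Set (Matrix (Fin k) (Fin k) ℝ), IsClosed K ∧
      (∀ X ∈ K, ∀ a b, X a b ∈ Set.Icc 0 c) ∧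
      HausdorffTendsto (fun i => matrixShape (S i) k) K

/-- The limit of the sequence of matrices `S` is `μ`: for all `k`, the limit shape of `C(S_i, k)`
is `C(μ, k)`. -/
def IsMatrixLimit {Ω : Type} [MeasurableSpace Ω] (ν : Measure Ω) {n : ℕ → ℕ}
    (S : ∀ i, Matrix (Fin (n i)) (Fin (n i)) ℝ) (μ : Measure (Ω × Ω)) : Prop :=
  ∀ k : ℕ, 0 < k → HausdorffTendsto (fun i => matrixShape (S i) k) (measureShape ν μ k)

/-- s-convergence of a sequence of graphs: all the shapes `C₀(G_i, k)` converge. -/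
def SConvergent {n : ℕ → ℕ} (G : ∀ i, SimpleGraph (Fin (n i))) : Prop :=
  ∀ k : ℕ, 0 < k → ∃ K : Set (Matrix (Fin k) (Fin k) ℝ), IsClosed K ∧
    HausdorffTendsto (fun i => graphShape (G i) k) K

/-- The s-limit of the sequence of graphs `G` is `μ`: for all `k`, the limit shape of `C₀(G_i, k)`
is `C(μ, k)`. -/
def IsSLimit {Ω : Type} [MeasurableSpace Ω] (ν : Measure Ω) {n : ℕ → ℕ}
    (G : ∀ i, SimpleGraph (Fin (n i))) (μ : Measure (Ω × Ω)) : Prop :=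
  ∀ k : ℕ, 0 < k → HausdorffTendsto (fun i => graphShape (G i) k) (measureShape ν μ k)

/-- A measure on `Ω × Ω` is symmetric if it is invariant under exchanging the coordinates. -/
def IsSymmetricMeasure {Ω : Type} [MeasurableSpace Ω] (μ : Measure (Ω × Ω)) : Prop :=
  μ.map Prod.swap = μ

/-- An s-graphon is a symmetric Borel probability measure on `[0, 1]²`. -/
def IsSGraphon (μ : Measure (unitInterval × unitInterval)) : Prop :=
  IsProbabilityMeasure μ ∧ IsSymmetricMeasure μ

/-- The product measure `ν` of the uniform measures on `{0, 1}` on the Cantor set `{0, 1}^ℕ`. -/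
def cantorMeasure : Measure (ℕ → Bool) :=
  Measure.infinitePi fun _ : ℕ => (PMF.uniformOfFintype Bool).toMeasure

end ShapeLimit

end

/-!
Cut `Ω` into cells `I_x` of equal `ν`-measure and let `S(x, y) = μ(I_x × I_y)`. Matrices in
`C(S, k)` are exactly the moment matrices of those `f` that are constant on cells
(`momentMatrix_comp`), so `C(S, k) ⊆ C(μ, k)`. Conversely, as the cells shrink, an arbitrary family
`f` is approximated by its averages over cells, in `L¹` of `ν` plus both marginals of `μ`; the
marginals have to be included since they may be singular to `ν`. This controls the moment matrix
and, up to a small error, the integrals `∫ f_i dν`, and a slight perturbation makes these integrals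
equal to `1 / k` again (`eventually_exists_matrixShape_near`). Compactness of `C(μ, k)` turns
approximation of single points into Hausdorff convergence (`hausdorffTendsto_closure`). This settles
the claims about matrices.

For graphs, let `S` be symmetric and nonnegative with entry sum `1`. Blow each index up to a block
`(ℤ / p)²` with `p` a large prime, and join the points `(u, v)` of block `x` and `(s, t)` of block
`y` when the residue of `u s + v + t` is less than `S(x, y) p`. For `s ≠ s'`, the map
`(u, v) ↦ (u s + v + t, u s' + v + t')` is a bijection, so that nearly all codegrees are exactly
those of a random graph. By Cauchy–Schwarz the adjacency matrix is close in cut norm to the blow-up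
of `S` (`abs_sum_adjMatrix_sub_le`). Since the rows of a fractional partition have entries in
`[0, 1]`, closeness in cut norm gives closeness of all shapes, and blowing up does not change the
shape (`hausdorffEDist_graphShape_le`).
-/

namespace ShapeLimit

/-! ### Shapes and Hausdorff convergence -/

theorem edist_toL1_le {k : ℕ} {X Y : Matrix (Fin k) (Fin k) ℝ} {ε : ℝ}
    (h : ∀ a b, |X a b - Y a b| ≤ ε) :
    edist (toL1 X) (toL1 Y) ≤ ENNReal.ofReal ((k : ℝ) ^ 2 * ε) := by
  rw [edist_dist, PiLp.dist_eq_of_L1]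
  refine ENNReal.ofReal_le_ofReal ?_
  calc ∑ p : Fin k × Fin k, dist ((toL1 X).ofLp p) ((toL1 Y).ofLp p)
      ≤ ∑ _p : Fin k × Fin k, ε := Finset.sum_le_sum fun p _ => h p.1 p.2
    _ = (k : ℝ) ^ 2 * ε := by
      simp [Finset.sum_const, Finset.card_univ, Fintype.card_prod, pow_two]

theorem continuous_toL1 {k : ℕ} : Continuous (toL1 (k := k)) :=
  (PiLp.continuous_toLp 1 _).comp (continuous_pi fun p => continuous_apply_apply p.1 p.2)

/-- Sets `A n ⊆ B` that eventually come close to each single point of a bounded set `B` converge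
to `closure B`: by compactness, closeness at the points of a finite net suffices. -/
theorem hausdorffTendsto_closure {k : ℕ} {A : ℕ → Set (Matrix (Fin k) (Fin k) ℝ)}
    {B : Set (Matrix (Fin k) (Fin k) ℝ)} {m : ℝ} (hB : ∀ X ∈ B, ∀ a b, X a b ∈ Set.Icc 0 m)
    (hAB : ∀ n, A n ⊆ B)
    (happrox : ∀ X ∈ B, ∀ ε > 0, ∀ᶠ n in atTop, ∃ Y ∈ A n, ∀ a b, |X a b - Y a b| ≤ ε) :
    HausdorffTendsto A (closure B) := by
  have hcpt : IsCompact (closure B) := by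
    have hK : IsCompact (Set.univ.pi fun _ => Set.univ.pi fun _ => Set.Icc (0 : ℝ) m :
        Set (Matrix (Fin k) (Fin k) ℝ)) :=
      isCompact_univ_pi fun _ => isCompact_univ_pi fun _ => isCompact_Icc
    refine hK.of_isClosed_subset isClosed_closure (closure_minimal ?_ hK.isClosed)
    intro X hX a _ b _
    exact hB X hX a b
  have htb : TotallyBounded (toL1 '' B) :=
    ((hcpt.image continuous_toL1).totallyBounded).subset (Set.image_mono subset_closure)
  unfold HausdorffTendsto
  have hcl : ∀ n, Metric.hausdorffEDist (toL1 '' A n) (toL1 '' closure B)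
      = Metric.hausdorffEDist (toL1 '' A n) (toL1 '' B) := by
    intro n
    have h : toL1 '' closure B = closure (toL1 '' B) := by
      rw [← hcpt.image continuous_toL1 |>.isClosed.closure_eq]
      refine subset_antisymm ?_ (closure_mono (Set.image_mono subset_closure))
      exact closure_minimal (image_closure_subset_closure_image continuous_toL1) isClosed_closure
    rw [h, Metric.hausdorffEDist_closure_right]
  simp only [hcl]
  rw [ENNReal.tendsto_nhds_zero]
  intro ε hε
  -- Only a finite `ε` can be converted to the real tolerance in `happrox`.
  rcases eq_or_ne ε ⊤ with rfl | hεt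
  · simp
  obtain ⟨t, htB, htfin, ht⟩ := EMetric.totallyBounded_iff'.1 htb (ε / 2)
    (ENNReal.half_pos hε.ne')
  have hpt : ∀ y ∈ t, ∀ᶠ n in atTop, ∃ z ∈ toL1 '' A n, edist y z ≤ ε / 2 := by
    intro y hy
    obtain ⟨X, hX, rfl⟩ := htB hy
    have hpos : 0 < (ε / 2).toReal :=
      ENNReal.toReal_pos (ENNReal.half_pos hε.ne').ne' (by finiteness)
    filter_upwards [happrox X hX ((ε / 2).toReal / ((k : ℝ) ^ 2 + 1)) (by positivity)] with n hn
    obtain ⟨Y, hY, hXY⟩ := hn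
    refine ⟨toL1 Y, ⟨Y, hY, rfl⟩, (edist_toL1_le hXY).trans ?_⟩
    refine (ENNReal.ofReal_le_ofReal ?_).trans (ENNReal.ofReal_toReal (by finiteness)).le
    rw [mul_div_assoc', div_le_iff₀ (by positivity)]
    nlinarith [sq_nonneg (k : ℝ)]
  have hall := (htfin.eventually_all).2 hpt
  filter_upwards [hall] with n hn
  refine Metric.hausdorffEDist_le_of_mem_edist ?_ ?_
  · rintro _ ⟨X, hX, rfl⟩
    exact ⟨toL1 X, ⟨X, hAB n hX, rfl⟩, by simp⟩
  · intro x hx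
    obtain ⟨y, hy, hxy⟩ := Set.mem_iUnion₂.1 (ht hx)
    obtain ⟨z, hz, hyz⟩ := hn y hy
    refine ⟨z, hz, ?_⟩
    calc edist x z ≤ edist x y + edist y z := edist_triangle _ _ _
      _ ≤ ε / 2 + ε / 2 := add_le_add (le_of_lt (by simpa using hxy)) hyz
      _ = ε := ENNReal.add_halves ε

/-! ### Averaging over the cells of a finite partition -/

/-- The average of `f` over the cell `{ω | e ω = x}` of the finite partition given by `e`. -/
noncomputable def cellAverage {Ω : Type} [MeasurableSpace Ω] (ρ : Measure Ω) {N : ℕ}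
    (e : Ω → Fin N) (f : Ω → ℝ) (x : Fin N) : ℝ :=
  ⨍ ω in e ⁻¹' {x}, f ω ∂ρ

section CellAverage

variable {Ω : Type} [MeasurableSpace Ω] {ρ : Measure Ω} {N : ℕ}
  {e : Ω → Fin N}

theorem integrable_comp_fin [IsFiniteMeasure ρ] (he : Measurable e) (c : Fin N → ℝ) :
    Integrable (fun ω => c (e ω)) ρ :=
  (Integrable.of_finite (μ := ρ.map e) (f := c)).comp_measurable he

theorem integral_comp_fin [IsFiniteMeasure ρ] (he : Measurable e) (c : Fin N → ℝ) :
    ∫ ω, c (e ω) ∂ρ = ∑ x, ρ.real (e ⁻¹' {x}) * c x := by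
  rw [← integral_map (φ := e) he.aemeasurable (measurable_of_finite c).aestronglyMeasurable,
    integral_fintype Integrable.of_finite]
  refine Finset.sum_congr rfl fun x _ => ?_
  rw [map_measureReal_apply he (measurableSet_singleton x), smul_eq_mul]

theorem integral_cellAverage [IsFiniteMeasure ρ] (he : Measurable e)
    {f : Ω → ℝ} (hf : Integrable f ρ) :
    ∫ ω, cellAverage ρ e f (e ω) ∂ρ = ∫ ω, f ω ∂ρ := by
  rw [integral_comp_fin he]
  have h : ⋃ x, e ⁻¹' {x} = Set.univ := by ext ω; simp
  rw [← setIntegral_univ (f := f), ← h,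
    integral_iUnion_fintype (fun x => he (measurableSet_singleton x))
      (fun x y hxy => Disjoint.preimage _ (by simpa using hxy)) fun x => hf.integrableOn]
  exact Finset.sum_congr rfl fun x _ => measure_smul_setAverage f (measure_ne_top _ _)

/-- Averaging `f` over cells is almost harmless in `L¹` if `f` is `L¹`-close to a function `g` that
oscillates little on each cell. -/
theorem integral_abs_sub_cellAverage_le [IsFiniteMeasure ρ] (he : Measurable e)
    (hpos : ∀ x, 0 < ρ.real (e ⁻¹' {x})) {f g : Ω → ℝ} (hf : Integrable f ρ)
    (hg : Integrable g ρ) {δ : ℝ} (hosc : ∀ ω ω', e ω = e ω' → |g ω - g ω'| ≤ δ) :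
    ∫ ω, |f ω - cellAverage ρ e f (e ω)| ∂ρ ≤ 2 * (∫ ω, |f ω - g ω| ∂ρ) + δ * ρ.real Set.univ := by
  have hfg : Integrable (fun ω => |f ω - g ω|) ρ := (hf.sub hg).abs
  have hpt : ∀ ω, |f ω - cellAverage ρ e f (e ω)|
      ≤ |f ω - g ω| + (cellAverage ρ e (fun ω => |f ω - g ω|) (e ω) + δ) := by
    intro ω
    set I := e ⁻¹' {e ω} with hI
    have hIm : MeasurableSet I := he (measurableSet_singleton _)
    have hne : ρ I ≠ 0 := fun h => (hpos (e ω)).ne' (by simp [measureReal_def, ← hI, h])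
    have hIne : NeZero (ρ.restrict I) := ⟨by simpa using hne⟩
    have hfI : Integrable f (ρ.restrict I) := hf.integrableOn
    have hgI : Integrable g (ρ.restrict I) := hg.integrableOn
    have hfgI : Integrable (fun ω => |f ω - g ω|) (ρ.restrict I) := hfg.integrableOn
    have hA : cellAverage ρ e f (e ω) - g ω = ⨍ ω' in I, (f ω' - g ω) ∂ρ := by
      rw [cellAverage, ← hI, setAverage_eq, setAverage_eq, integral_sub hfI (integrable_const _),
        integral_const, smul_sub, measureReal_restrict_apply_univ, smul_smul, inv_mul_cancel₀
        (hpos (e ω)).ne', one_smul]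
    have hle : |cellAverage ρ e f (e ω) - g ω|
        ≤ cellAverage ρ e (fun ω => |f ω - g ω|) (e ω) + δ := by
      rw [hA]
      have hδ : cellAverage ρ e (fun ω => |f ω - g ω|) (e ω) + δ
          = ⨍ ω' in I, (|f ω' - g ω'| + δ) ∂ρ := by
        rw [cellAverage, ← hI, setAverage_eq, setAverage_eq,
          integral_add hfgI (integrable_const _),
          integral_const, smul_add, measureReal_restrict_apply_univ, smul_smul, inv_mul_cancel₀
          (hpos (e ω)).ne', one_smul]
      rw [hδ, setAverage_eq, setAverage_eq, smul_eq_mul, smul_eq_mul, abs_mul,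
        abs_of_nonneg (inv_nonneg.2 measureReal_nonneg)]
      refine mul_le_mul_of_nonneg_left ?_ (inv_nonneg.2 measureReal_nonneg)
      refine abs_integral_le_integral_abs.trans ?_
      refine setIntegral_mono_on (hfI.sub (integrable_const _)).abs
        (hfgI.add (integrable_const _)) hIm fun ω' hω' => ?_
      have := hosc ω' ω hω'
      calc |f ω' - g ω| = |(f ω' - g ω') + (g ω' - g ω)| := by ring_nf
        _ ≤ |f ω' - g ω'| + |g ω' - g ω| := abs_add_le _ _
        _ ≤ _ := by linarith
    calc |f ω - cellAverage ρ e f (e ω)|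
        = |(f ω - g ω) - (cellAverage ρ e f (e ω) - g ω)| := by ring_nf
      _ ≤ |f ω - g ω| + |cellAverage ρ e f (e ω) - g ω| := abs_sub _ _
      _ ≤ _ := by linarith
  have hint : Integrable (fun ω => cellAverage ρ e (fun ω => |f ω - g ω|) (e ω)) ρ :=
    integrable_comp_fin he _
  calc ∫ ω, |f ω - cellAverage ρ e f (e ω)| ∂ρ
      ≤ ∫ ω, (|f ω - g ω| + (cellAverage ρ e (fun ω => |f ω - g ω|) (e ω) + δ)) ∂ρ :=
        integral_mono (hf.sub (integrable_comp_fin he _)).abs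
          (hfg.add (hint.add (integrable_const _))) hpt
    _ = _ := by
      have h := integral_add hfg (hint.add (integrable_const δ))
      simp only [Pi.add_apply] at h
      rw [h, integral_add hint (integrable_const _),
        integral_cellAverage he hfg, integral_const, smul_eq_mul]
      ring

theorem cellAverage_nonneg {f : Ω → ℝ} (hf : ∀ ω, 0 ≤ f ω) (x : Fin N) :
    0 ≤ cellAverage ρ e f x := by
  rw [cellAverage, setAverage_eq, smul_eq_mul]
  exact mul_nonneg (inv_nonneg.2 measureReal_nonneg) (integral_nonneg hf)

theorem sum_cellAverage {ι : Type} [Fintype ι] (hpos : ∀ x, 0 < ρ.real (e ⁻¹' {x}))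
    {f : ι → Ω → ℝ} (hf : ∀ i, Integrable (f i) ρ) (hsum : ∀ ω, ∑ i, f i ω = 1) (x : Fin N) :
    ∑ i, cellAverage ρ e (f i) x = 1 := by
  simp only [cellAverage, setAverage_eq]
  rw [← Finset.smul_sum, ← integral_finsetSum _ fun i _ => (hf i).integrableOn]
  simp only [hsum, integral_const, measureReal_restrict_apply_univ, smul_eq_mul, mul_one]
  exact inv_mul_cancel₀ (hpos x).ne'

end CellAverage

/-! ### Matrices of cell masses -/

/-- The matrix `S(x, y) = μ(I_x × I_y)` of the masses of the products of the cells
`I_x = {ω | e ω = x}` of a finite partition of `Ω`. -/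
noncomputable def cellMatrix {Ω : Type} [MeasurableSpace Ω] (μ : Measure (Ω × Ω)) {N : ℕ}
    (e : Ω → Fin N) : Matrix (Fin N) (Fin N) ℝ :=
  Matrix.of fun x y => μ.real ((e ⁻¹' {x}) ×ˢ (e ⁻¹' {y}))

section CellMatrix

variable {Ω : Type} [MeasurableSpace Ω] {ν : Measure Ω} {μ : Measure (Ω × Ω)} {N k : ℕ}
  {e : Ω → Fin N}

theorem integral_comp_fin_prod [IsFiniteMeasure μ] (he : Measurable e)
    (F : Fin N → Fin N → ℝ) :
    ∫ z, F (e z.1) (e z.2) ∂μ = ∑ x, ∑ y, F x y * cellMatrix μ e x y := by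
  have hm : Measurable (fun z : Ω × Ω => (e z.1, e z.2)) := by fun_prop
  have h := integral_map (μ := μ) hm.aemeasurable
    (f := fun p : Fin N × Fin N => F p.1 p.2) (measurable_of_finite _).aestronglyMeasurable
  rw [← h, integral_fintype Integrable.of_finite, Fintype.sum_prod_type]
  refine Finset.sum_congr rfl fun x _ => Finset.sum_congr rfl fun y _ => ?_
  rw [map_measureReal_apply hm (measurableSet_singleton _), smul_eq_mul, mul_comm]
  congr 2
  ext z
  simp

/-- The matrices in the shape of `cellMatrix μ e` are the moment matrices of step functions. -/
theorem momentMatrix_comp [IsFiniteMeasure μ] (he : Measurable e)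
    (M : Matrix (Fin k) (Fin N) ℝ) :
    momentMatrix μ (fun i ω => M i (e ω)) = M * cellMatrix μ e * M.transpose := by
  ext i j
  simp only [momentMatrix, Matrix.of_apply]
  rw [integral_comp_fin_prod he (fun x y => M i x * M j y)]
  simp only [Matrix.mul_apply, Matrix.transpose_apply, Finset.sum_mul]
  rw [Finset.sum_comm]
  exact Finset.sum_congr rfl fun x _ => Finset.sum_congr rfl fun y _ => by ring

theorem entrySum_cellMatrix [IsFiniteMeasure μ] (he : Measurable e) :
    entrySum (cellMatrix μ e) = μ.real Set.univ := by
  have h := integral_comp_fin_prod (μ := μ) he (fun _ _ => 1)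
  simp only [integral_const, smul_eq_mul, mul_one, one_mul] at h
  exact h.symm

theorem cellMatrix_nonneg (x y : Fin N) : 0 ≤ cellMatrix μ e x y := measureReal_nonneg

theorem cellMatrix_isSymm (hμ : IsSymmetricMeasure μ) (he : Measurable e) :
    (cellMatrix μ e).IsSymm := by
  ext x y
  have hx := he (measurableSet_singleton x)
  have hy := he (measurableSet_singleton y)
  simp only [Matrix.transpose_apply, cellMatrix, Matrix.of_apply]
  conv_lhs => rw [← hμ]
  rw [map_measureReal_apply measurable_swap (hy.prod hx)]
  congr 1
  ext z
  simp

theorem comp_mem_functionPartitions [IsFiniteMeasure ν] (hN : 0 < N) (he : Measurable e)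
    (hν : ∀ x, ν.real (e ⁻¹' {x}) = 1 / N) {M : Matrix (Fin k) (Fin N) ℝ}
    (hM : M ∈ fractionalPartitions k (Fin N)) :
    (fun i ω => M i (e ω)) ∈ functionPartitions ν k := by
  obtain ⟨h0, hrow, hcol⟩ := hM
  refine ⟨fun i => (measurable_of_finite (M i)).comp he, fun i ω => h0 i _, fun ω => hcol _,
    fun i => ?_⟩
  rw [integral_comp_fin he]
  simp only [hν]
  rw [← Finset.mul_sum, hrow, Fintype.card_fin]
  have : (N : ℝ) ≠ 0 := by exact_mod_cast hN.ne'
  field_simp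

theorem le_one_of_sum_eq_one {ι : Type} [Fintype ι] {c : ι → ℝ} (h0 : ∀ i, 0 ≤ c i)
    (h : ∑ i, c i = 1) (i : ι) : c i ≤ 1 :=
  h ▸ Finset.single_le_sum (f := c) (fun j _ => h0 j) (Finset.mem_univ i)

/-- A partition of unity on `Fin N` whose row averages are close to `1 / k` is close to a fractional
partition: shrink it slightly and add the constants that restore the row sums. -/
theorem exists_fractionalPartition_near (hN : 0 < N) (hk : 0 < k) {h : Matrix (Fin k) (Fin N) ℝ}
    (h0 : ∀ i x, 0 ≤ h i x) (hcol : ∀ x, ∑ i, h i x = 1) {δ : ℝ} (hδ : 0 ≤ δ)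
    (hkδ : k * δ ≤ 1) (hrow : ∀ i, |(∑ x, h i x) / N - 1 / k| ≤ δ) :
    ∃ M ∈ fractionalPartitions k (Fin N), ∀ i x, |M i x - h i x| ≤ 2 * k * δ := by
  have hN' : (N : ℝ) ≠ 0 := by exact_mod_cast hN.ne'
  have hk' : (0 : ℝ) < k := by exact_mod_cast hk
  have hk1 : (1 : ℝ) ≤ k := by exact_mod_cast hk
  set a : Fin k → ℝ := fun i => (∑ x, h i x) / N with ha
  have hsum : ∀ i, ∑ x, h i x = N * a i := fun i => by simp only [ha]; field_simp
  have h1 : ∀ i x, h i x ≤ 1 := fun i x =>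
    le_one_of_sum_eq_one (fun i => h0 i x) (hcol x) i
  have hasum : ∑ i, a i = 1 := by
    simp only [ha, ← Finset.sum_div]
    rw [show ∑ i, ∑ x, h i x = ∑ x, ∑ i, h i x from Finset.sum_comm]
    simp [hcol, hN']
  have ha0 : ∀ i, 0 ≤ a i := fun i =>
    div_nonneg (Finset.sum_nonneg fun x _ => h0 i x) (Nat.cast_nonneg N)
  have ha1 : ∀ i, a i ≤ 1 := le_one_of_sum_eq_one ha0 hasum
  have hc : ∀ i, 0 ≤ 1 / k - (1 - k * δ) * a i := by
    intro i
    have h2 := (abs_le.1 (hrow i)).2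
    have h3 : (1 - k * δ) * a i ≤ (1 - k * δ) * (1 / k + δ) :=
      mul_le_mul_of_nonneg_left (by linarith) (by linarith)
    have h4 : (1 - k * δ) * (1 / k + δ) = 1 / k - k * δ ^ 2 := by field_simp; ring
    have : 0 ≤ k * δ ^ 2 := by positivity
    linarith
  refine ⟨Matrix.of fun i x => (1 - k * δ) * h i x + (1 / k - (1 - k * δ) * a i),
    ⟨fun i x => ?_, fun i => ?_, fun x => ?_⟩, fun i x => ?_⟩
  · exact add_nonneg (mul_nonneg (by linarith) (h0 i x)) (hc i)
  · simp only [Matrix.of_apply, Finset.sum_add_distrib, ← Finset.mul_sum, hsum, Finset.sum_const,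
      Finset.card_univ, Fintype.card_fin, nsmul_eq_mul]
    ring
  · simp only [Matrix.of_apply, Finset.sum_add_distrib, Finset.sum_sub_distrib, ← Finset.mul_sum,
      hcol, hasum, Finset.sum_const, Finset.card_univ, Fintype.card_fin, nsmul_eq_mul]
    field_simp
    ring
  · have h2 := abs_le.1 (hrow i)
    have hkδ0 : 0 ≤ k * δ := by positivity
    have h3 : δ ≤ k * δ := le_mul_of_one_le_left hδ hk1
    have e1 : k * δ * h i x ≤ k * δ := mul_le_of_le_one_right hkδ0 (h1 i x)
    have e2 : k * δ * a i ≤ k * δ := mul_le_of_le_one_right hkδ0 (ha1 i)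
    have e3 : 0 ≤ k * δ * h i x := mul_nonneg hkδ0 (h0 i x)
    have e4 : 0 ≤ k * δ * a i := mul_nonneg hkδ0 (ha0 i)
    rw [Matrix.of_apply, abs_le]
    constructor <;> nlinarith

theorem integrable_of_mem_unit {α : Type} [MeasurableSpace α] {ρ : Measure α} [IsFiniteMeasure ρ]
    {f : α → ℝ} (hf : Measurable f) (h0 : ∀ ω, 0 ≤ f ω) (h1 : ∀ ω, f ω ≤ 1) : Integrable f ρ :=
  Integrable.of_bound hf.aestronglyMeasurable 1
    (Eventually.of_forall fun ω => by rw [Real.norm_of_nonneg (h0 ω)]; exact h1 ω)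

/-- The moment matrix depends on `f` continuously in `L¹` of the two marginals of `μ`. -/
theorem abs_momentMatrix_sub_le [IsFiniteMeasure μ] {f g : Fin k → Ω → ℝ}
    (hfm : ∀ i, Measurable (f i)) (hf0 : ∀ i ω, 0 ≤ f i ω) (hf1 : ∀ i ω, f i ω ≤ 1)
    (hgm : ∀ i, Measurable (g i)) (hg0 : ∀ i ω, 0 ≤ g i ω) (hg1 : ∀ i ω, g i ω ≤ 1)
    (i j : Fin k) :
    |momentMatrix μ f i j - momentMatrix μ g i j|
      ≤ ∫ ω, |f i ω - g i ω| ∂μ.fst + ∫ ω, |f j ω - g j ω| ∂μ.snd := by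
  have hint : ∀ f : Fin k → Ω → ℝ, (∀ i, Measurable (f i)) → (∀ i ω, 0 ≤ f i ω) →
      (∀ i ω, f i ω ≤ 1) → Integrable (fun z : Ω × Ω => f i z.1 * f j z.2) μ :=
    fun f hm h0 h1 => integrable_of_mem_unit (((hm i).comp measurable_fst).mul
      ((hm j).comp measurable_snd)) (fun z => mul_nonneg (h0 i _) (h0 j _))
      (fun z => mul_le_one₀ (h1 i _) (h0 j _) (h1 j _))
  have hd : ∀ i, Measurable fun ω => |f i ω - g i ω| := fun i => ((hfm i).sub (hgm i)).abs
  have hdi : ∀ i (ρ : Measure Ω) [IsFiniteMeasure ρ], Integrable (fun ω => |f i ω - g i ω|) ρ :=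
    fun i ρ _ => integrable_of_mem_unit (hd i) (fun ω => abs_nonneg _) fun ω => by
      rw [abs_le]; constructor <;> linarith [hf0 i ω, hf1 i ω, hg0 i ω, hg1 i ω]
  rw [Measure.fst, Measure.snd,
    integral_map measurable_fst.aemeasurable (hd i).aestronglyMeasurable,
    integral_map measurable_snd.aemeasurable (hd j).aestronglyMeasurable,
    ← integral_add (f := fun z : Ω × Ω => |f i z.1 - g i z.1|)
      (g := fun z : Ω × Ω => |f j z.2 - g j z.2|)
      ((hdi i μ.fst).comp_measurable measurable_fst)
      ((hdi j μ.snd).comp_measurable measurable_snd)]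
  simp only [momentMatrix, Matrix.of_apply]
  rw [← integral_sub (hint f hfm hf0 hf1) (hint g hgm hg0 hg1)]
  refine abs_integral_le_integral_abs.trans (integral_mono
    ((hint f hfm hf0 hf1).sub (hint g hgm hg0 hg1)).abs
    (((hdi i μ.fst).comp_measurable measurable_fst).add
      ((hdi j μ.snd).comp_measurable measurable_snd)) fun z => ?_)
  calc |f i z.1 * f j z.2 - g i z.1 * g j z.2|
      = |(f i z.1 - g i z.1) * f j z.2 + g i z.1 * (f j z.2 - g j z.2)| := by ring_nf
    _ ≤ |(f i z.1 - g i z.1) * f j z.2| + |g i z.1 * (f j z.2 - g j z.2)| := abs_add_le _ _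
    _ ≤ |f i z.1 - g i z.1| + |f j z.2 - g j z.2| := by
      rw [abs_mul, abs_mul, abs_of_nonneg (hf0 j _), abs_of_nonneg (hg0 i _)]
      exact add_le_add (mul_le_of_le_one_right (abs_nonneg _) (hf1 j _))
        (mul_le_of_le_one_left (abs_nonneg _) (hg1 i _))

theorem momentMatrix_mem_Icc [IsFiniteMeasure μ] {f : Fin k → Ω → ℝ}
    (hf : f ∈ functionPartitions ν k) (i j : Fin k) :
    momentMatrix μ f i j ∈ Set.Icc 0 (μ.real Set.univ) := by
  obtain ⟨hm, h0, hs, -⟩ := hf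
  have h1 := fun i ω => le_one_of_sum_eq_one (fun i => h0 i ω) (hs ω) i
  simp only [momentMatrix, Matrix.of_apply]
  refine ⟨integral_nonneg fun z => mul_nonneg (h0 i _) (h0 j _), ?_⟩
  have h := integral_mono (μ := μ) (f := fun z : Ω × Ω => f i z.1 * f j z.2) (g := fun _ => 1)
    (integrable_of_mem_unit (((hm i).comp measurable_fst).mul
      ((hm j).comp measurable_snd)) (fun z => mul_nonneg (h0 i _) (h0 j _))
      (fun z => mul_le_one₀ (h1 i _) (h0 j _) (h1 j _))) (integrable_const _)
      (fun z => mul_le_one₀ (h1 i _) (h0 j _) (h1 j _))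
  simpa using h

theorem matrixShape_cellMatrix_subset [IsFiniteMeasure ν] [IsFiniteMeasure μ] (hN : 0 < N)
    (he : Measurable e) (hν : ∀ x, ν.real (e ⁻¹' {x}) = 1 / N) :
    matrixShape (cellMatrix μ e) k ⊆ momentMatrix μ '' functionPartitions ν k := by
  rintro _ ⟨M, hM, rfl⟩
  exact ⟨_, comp_mem_functionPartitions hN he hν hM, momentMatrix_comp he M⟩

end CellMatrix

/-! ### Partitions with shrinking cells -/

theorem matrixConvergent_of_isMatrixLimit {Ω : Type} [MeasurableSpace Ω] {ν : Measure Ω}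
    {μ : Measure (Ω × Ω)} [IsFiniteMeasure μ] {N : ℕ → ℕ}
    {S : ∀ n, Matrix (Fin (N n)) (Fin (N n)) ℝ} (hS : ∀ n, entrySum (S n) = μ.real Set.univ)
    (hlim : IsMatrixLimit ν S μ) : MatrixConvergent S := by
  have hm : 0 ≤ μ.real Set.univ := measureReal_nonneg
  refine ⟨μ.real Set.univ + 1, by linarith, fun n => by rw [hS]; linarith, fun k hk =>
    ⟨measureShape ν μ k, isClosed_closure, ?_, hlim k hk⟩⟩
  have hcl : IsClosed {X : Matrix (Fin k) (Fin k) ℝ |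
      ∀ a b, X a b ∈ Set.Icc 0 (μ.real Set.univ + 1)} := by
    simp only [Set.ofPred_forall]
    exact isClosed_iInter fun a => isClosed_iInter fun b =>
      isClosed_Icc.preimage (continuous_apply_apply a b)
  refine fun X hX => closure_minimal (t := {X : Matrix (Fin k) (Fin k) ℝ |
      ∀ a b, X a b ∈ Set.Icc 0 (μ.real Set.univ + 1)}) ?_ hcl hX
  rintro _ ⟨f, hf, rfl⟩ a b
  have := momentMatrix_mem_Icc (μ := μ) hf a b
  exact ⟨this.1, by linarith [this.2]⟩

section ShrinkingCells

variable {Ω : Type} [UniformSpace Ω] [CompactSpace Ω] [TopologicalSpace.PseudoMetrizableSpace Ω]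
  [MeasurableSpace Ω] [BorelSpace Ω] {ν : Measure Ω} [IsProbabilityMeasure ν]
  {N : ℕ → ℕ} {e : ∀ n, Ω → Fin (N n)}

/-- Every moment matrix is a limit of moment matrices of step functions. The average of `f` is taken
with respect to `ν` plus both marginals of `μ`, because these marginals may be singular to `ν`. -/
theorem eventually_exists_matrixShape_near (μ : Measure (Ω × Ω)) [IsFiniteMeasure μ]
    (hN : ∀ n, 0 < N n) (he : ∀ n, Measurable (e n))
    (hν : ∀ n x, ν.real (e n ⁻¹' {x}) = 1 / N n)
    (hmesh : ∀ V ∈ uniformity Ω, ∀ᶠ n in atTop, ∀ ω ω', e n ω = e n ω' → (ω, ω') ∈ V)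
    {k : ℕ} (hk : 0 < k) {f : Fin k → Ω → ℝ} (hf : f ∈ functionPartitions ν k)
    {ε : ℝ} (hε : 0 < ε) :
    ∀ᶠ n in atTop, ∃ Y ∈ matrixShape (cellMatrix μ (e n)) k,
      ∀ i j, |momentMatrix μ f i j - Y i j| ≤ ε := by
  obtain ⟨hm, h0, hs, hi⟩ := hf
  have h1 := fun i ω => le_one_of_sum_eq_one (fun i => h0 i ω) (hs ω) i
  have hk' : (0 : ℝ) < k := by exact_mod_cast hk
  set ρ : Measure Ω := ν + μ.fst + μ.snd with hρ
  set T := ρ.real Set.univ with hT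
  set m := μ.real Set.univ with hmdef
  have hT0 : 0 ≤ T := measureReal_nonneg
  have hm0 : 0 ≤ m := measureReal_nonneg
  -- `δ` bounds the `L¹` error of averaging, and `4 k δ m` the effect of restoring the integrals.
  set δ := min (1 / (k : ℝ)) (ε / (2 + 4 * k * m)) with hδdef
  have hδ : 0 < δ := lt_min (by positivity) (by positivity)
  have hkδ : k * δ ≤ 1 := by
    calc k * δ ≤ k * (1 / (k : ℝ)) := by gcongr; exact min_le_left _ _
      _ = 1 := by field_simp
  have hδε : δ * (2 + 4 * k * m) ≤ ε := by
    rw [← le_div_iff₀ (by positivity)]; exact min_le_right _ _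
  set η := δ / (2 + T) with hηdef
  have hη : 0 < η := by positivity
  have hηδ : 2 * η + η * T = δ := by rw [hηdef]; field_simp
  have hfi : ∀ i (ρ : Measure Ω) [IsFiniteMeasure ρ], Integrable (f i) ρ :=
    fun i ρ _ => integrable_of_mem_unit (hm i) (h0 i) (h1 i)
  have hg : ∀ i, ∃ g : BoundedContinuousFunction Ω ℝ, ∫ ω, ‖f i ω - g ω‖ ∂ρ ≤ η ∧
      Integrable g ρ := fun i =>
    (hfi i ρ).exists_boundedContinuous_integral_sub_le hη
  choose g hfg hgi using hg
  have hosc : ∀ i, ∀ᶠ n in atTop, ∀ ω ω', e n ω = e n ω' → |g i ω - g i ω'| ≤ η := by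
    intro i
    have huc := CompactSpace.uniformContinuous_of_continuous (g i).continuous
    filter_upwards [hmesh _ (huc (Metric.dist_mem_uniformity hη))] with n hn ω ω' h
    have := hn ω ω' h
    simp only [Set.mem_preimage, Set.mem_ofPred_eq, Real.dist_eq] at this
    exact this.le
  filter_upwards [eventually_all.2 hosc] with n hn
  have hNn : (0 : ℝ) < N n := by exact_mod_cast hN n
  have hνρ : ν ≤ ρ := by rw [hρ, add_assoc]; exact Measure.le_add_right le_rfl
  have hfst : μ.fst ≤ ρ := Measure.le_add_right (Measure.le_add_left le_rfl)
  have hsnd : μ.snd ≤ ρ := Measure.le_add_left le_rfl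
  have hpos : ∀ x, 0 < ρ.real (e n ⁻¹' {x}) := fun x => by
    refine lt_of_lt_of_le ?_ (ENNReal.toReal_mono (measure_ne_top _ _) (hνρ _))
    rw [← measureReal_def, hν]
    positivity
  set h : Matrix (Fin k) (Fin (N n)) ℝ := Matrix.of fun i x => cellAverage ρ (e n) (f i) x
  have hh0 : ∀ i x, 0 ≤ h i x := fun i x => cellAverage_nonneg (h0 i) x
  have hhs : ∀ x, ∑ i, h i x = 1 := sum_cellAverage hpos (fun i => hfi i ρ) hs
  have hh1 := fun i x => le_one_of_sum_eq_one (fun i => hh0 i x) (hhs x) i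
  have hhi : ∀ i (ρ : Measure Ω) [IsFiniteMeasure ρ], Integrable (fun ω => h i (e n ω)) ρ :=
    fun i ρ _ => integrable_comp_fin (he n) (h i)
  have hclose : ∀ i, ∫ ω, |f i ω - h i (e n ω)| ∂ρ ≤ δ := fun i => by
    refine (integral_abs_sub_cellAverage_le (he n) hpos (hfi i ρ) (hgi i) (hn i)).trans ?_
    have := hfg i
    simp only [Real.norm_eq_abs] at this
    linarith
  have hclose' : ∀ i (ρ' : Measure Ω), ρ' ≤ ρ → ∫ ω, |f i ω - h i (e n ω)| ∂ρ' ≤ δ :=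
    fun i ρ' hle => (integral_mono_measure hle (Eventually.of_forall fun ω => abs_nonneg _)
      ((hfi i ρ).sub (hhi i ρ)).abs).trans (hclose i)
  have hrow : ∀ i, |(∑ x, h i x) / N n - 1 / k| ≤ δ := by
    intro i
    have e1 : (∑ x, h i x) / N n = ∫ ω, h i (e n ω) ∂ν := by
      rw [integral_comp_fin (he n)]
      simp only [hν, ← Finset.mul_sum]
      ring
    rw [e1, ← hi i, abs_sub_comm, ← integral_sub (hfi i ν) (hhi i ν)]
    exact abs_integral_le_integral_abs.trans (hclose' i ν hνρ)
  obtain ⟨M, hM, hMh⟩ := exists_fractionalPartition_near (hN n) hk hh0 hhs hδ.le hkδ hrow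
  refine ⟨_, ⟨M, hM, rfl⟩, fun i j => ?_⟩
  rw [← momentMatrix_comp (he n)]
  have hM1 := fun i x => le_one_of_sum_eq_one (fun i => hM.1 i x) (hM.2.2 x) i
  have hmeas : ∀ (c : Matrix (Fin k) (Fin (N n)) ℝ) i, Measurable fun ω => c i (e n ω) :=
    fun c i => (measurable_of_finite (c i)).comp (he n)
  have b1 := abs_momentMatrix_sub_le (μ := μ) hm h0 h1 (hmeas h)
    (fun i ω => hh0 i _) (fun i ω => hh1 i _) i j
  have b2 := abs_momentMatrix_sub_le (μ := μ) (hmeas h)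
    (fun i ω => hh0 i _) (fun i ω => hh1 i _) (hmeas M)
    (fun i ω => hM.1 i _) (fun i ω => hM1 i _) i j
  have hconst : ∀ (ρ' : Measure Ω) [IsFiniteMeasure ρ'], ρ'.real Set.univ = m → ∀ i,
      ∫ ω, |h i (e n ω) - M i (e n ω)| ∂ρ' ≤ 2 * k * δ * m := by
    intro ρ' _ hρ' i
    calc ∫ ω, |h i (e n ω) - M i (e n ω)| ∂ρ' ≤ ∫ _, 2 * k * δ ∂ρ' := by
          refine integral_mono ((hhi i ρ').sub (integrable_comp_fin (he n) (M i))).abs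
            (integrable_const _) fun ω => ?_
          simpa only [abs_sub_comm] using hMh i (e n ω)
      _ = _ := by rw [integral_const, hρ', smul_eq_mul, mul_comm]
  have c1 := hconst μ.fst (by rw [measureReal_def, Measure.fst_univ, hmdef, measureReal_def]) i
  have c2 := hconst μ.snd (by rw [measureReal_def, Measure.snd_univ, hmdef, measureReal_def]) j
  have d1 := hclose' i μ.fst hfst
  have d2 := hclose' j μ.snd hsnd
  calc |momentMatrix μ f i j - momentMatrix μ (fun i ω => M i (e n ω)) i j|
      ≤ |momentMatrix μ f i j - momentMatrix μ (fun i ω => h i (e n ω)) i j|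
        + |momentMatrix μ (fun i ω => h i (e n ω)) i j
          - momentMatrix μ (fun i ω => M i (e n ω)) i j| := abs_sub_le _ _ _
    _ ≤ (δ + δ) + (2 * k * δ * m + 2 * k * δ * m) := by linarith
    _ = δ * (2 + 4 * k * m) := by ring
    _ ≤ ε := hδε

theorem isMatrixLimit_cellMatrix (μ : Measure (Ω × Ω)) [IsFiniteMeasure μ]
    (hN : ∀ n, 0 < N n) (he : ∀ n, Measurable (e n))
    (hν : ∀ n x, ν.real (e n ⁻¹' {x}) = 1 / N n)
    (hmesh : ∀ V ∈ uniformity Ω, ∀ᶠ n in atTop, ∀ ω ω', e n ω = e n ω' → (ω, ω') ∈ V) :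
    IsMatrixLimit ν (fun n => cellMatrix μ (e n)) μ := by
  intro k hk
  refine hausdorffTendsto_closure (m := μ.real Set.univ) ?_
    (fun n => matrixShape_cellMatrix_subset (hN n) (he n) (hν n)) ?_
  · rintro _ ⟨f, hf, rfl⟩ a b
    exact momentMatrix_mem_Icc hf a b
  · rintro _ ⟨f, hf, rfl⟩ ε hε
    exact eventually_exists_matrixShape_near μ hN he hν hmesh hk hf hε

/-- The matrices of cell masses converge to `μ` for every sequence of partitions into cells of equal
`ν`-measure that eventually lie below every entourage in size. The partitions need not be nested. -/
theorem exists_matrices_of_shrinking_cells (hN : ∀ n, 0 < N n) (he : ∀ n, Measurable (e n))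
    (hν : ∀ n x, ν.real (e n ⁻¹' {x}) = 1 / N n)
    (hmesh : ∀ V ∈ uniformity Ω, ∀ᶠ n in atTop, ∀ ω ω', e n ω = e n ω' → (ω, ω') ∈ V)
    (μ : Measure (Ω × Ω)) (hfin : IsFiniteMeasure μ) (hμ : IsSymmetricMeasure μ) :
    ∃ (n : ℕ → ℕ) (S : ∀ i, Matrix (Fin (n i)) (Fin (n i)) ℝ),
      (∀ i, 0 < n i) ∧ (∀ i, (S i).IsSymm) ∧ (∀ i x y, 0 ≤ S i x y) ∧
      (∀ i, entrySum (S i) = μ.real Set.univ) ∧ MatrixConvergent S ∧ IsMatrixLimit ν S μ := by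
  have hsum : ∀ n, entrySum (cellMatrix μ (e n)) = μ.real Set.univ :=
    fun n => entrySum_cellMatrix (he n)
  have hlim := isMatrixLimit_cellMatrix μ hN he hν hmesh
  exact ⟨N, fun n => cellMatrix μ (e n), hN, fun n => cellMatrix_isSymm hμ (he n),
    fun n => cellMatrix_nonneg, hsum, matrixConvergent_of_isMatrixLimit hsum hlim, hlim⟩

end ShrinkingCells

/-! ### Partitions of the unit interval and of the Cantor set -/

/-- The index of the interval of length `1 / (n + 1)` that contains `x`. The minimum puts the
endpoint `1` into the last interval. -/
noncomputable def intervalIndex (n : ℕ) (x : unitInterval) : Fin (n + 1) :=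
  ⟨min ⌊((n : ℝ) + 1) * x⌋₊ n, by omega⟩

theorem intervalIndex_of_lt {n : ℕ} {j : Fin (n + 1)} (hj : (j : ℕ) < n) :
    intervalIndex n ⁻¹' {j} =
      {x : unitInterval | (j : ℝ) / (n + 1) ≤ x ∧ (x : ℝ) < (j + 1) / (n + 1)} := by
  ext x
  have hn : (0 : ℝ) < n + 1 := by positivity
  have hx : 0 ≤ ((n : ℝ) + 1) * x := mul_nonneg hn.le x.2.1
  have h : min ⌊((n : ℝ) + 1) * x⌋₊ n = j ↔ ⌊((n : ℝ) + 1) * x⌋₊ = j := by omega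
  simp only [Set.mem_preimage, Set.mem_singleton_iff, Fin.ext_iff, intervalIndex, h,
    Nat.floor_eq_iff hx, Set.mem_ofPred_eq, div_le_iff₀ hn, lt_div_iff₀ hn, mul_comm (x : ℝ)]

theorem intervalIndex_last {n : ℕ} {j : Fin (n + 1)} (hj : (j : ℕ) = n) :
    intervalIndex n ⁻¹' {j} =
      {x : unitInterval | (j : ℝ) / (n + 1) ≤ x} := by
  ext x
  have hn : (0 : ℝ) < n + 1 := by positivity
  have hx : 0 ≤ ((n : ℝ) + 1) * x := mul_nonneg hn.le x.2.1
  have h : min ⌊((n : ℝ) + 1) * x⌋₊ n = n ↔ n ≤ ⌊((n : ℝ) + 1) * x⌋₊ := by omega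
  simp only [Set.mem_preimage, Set.mem_singleton_iff, Fin.ext_iff, intervalIndex, hj, h,
    Nat.le_floor_iff hx, Set.mem_ofPred_eq, div_le_iff₀ hn, mul_comm (x : ℝ)]

theorem measurable_intervalIndex (n : ℕ) : Measurable (intervalIndex n) := by
  refine measurable_to_countable' fun j => ?_
  rcases (Nat.lt_succ_iff.1 j.2).lt_or_eq with hj | hj
  · rw [intervalIndex_of_lt hj]
    exact (measurableSet_le measurable_const measurable_subtype_coe).inter
      (measurableSet_lt measurable_subtype_coe measurable_const)
  · rw [intervalIndex_last hj]
    exact measurableSet_le measurable_const measurable_subtype_coe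

theorem volume_intervalIndex (n : ℕ) (j : Fin (n + 1)) :
    (volume : Measure unitInterval).real (intervalIndex n ⁻¹' {j}) = 1 / ((n + 1 : ℕ) : ℝ) := by
  have hn : (0 : ℝ) < n + 1 := by positivity
  have hjn : (j : ℝ) ≤ n := by exact_mod_cast Nat.lt_succ_iff.1 j.2
  have ha : (j : ℝ) / (n + 1) ∈ unitInterval :=
    ⟨by positivity, by rw [div_le_one hn]; linarith⟩
  rcases (Nat.lt_succ_iff.1 j.2).lt_or_eq with hj | hj
  · have hjn' : (j : ℝ) + 1 ≤ n := by exact_mod_cast hj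
    have hb : ((j : ℝ) + 1) / (n + 1) ∈ unitInterval :=
      ⟨by positivity, by rw [div_le_one hn]; linarith⟩
    have : intervalIndex n ⁻¹' {j} = Set.Ico ⟨_, ha⟩ ⟨_, hb⟩ := by
      rw [intervalIndex_of_lt hj]; rfl
    rw [this, measureReal_def, unitInterval.volume_Ico, ← sub_div, ENNReal.toReal_ofReal]
    · push_cast; ring
    · rw [add_sub_cancel_left]; positivity
  · have : intervalIndex n ⁻¹' {j} = Set.Icc ⟨_, ha⟩ 1 := by
      rw [intervalIndex_last hj]
      ext x
      exact ⟨fun h => ⟨h, x.2.2⟩, fun h => h.1⟩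
    have hjr : (j : ℝ) = n := by exact_mod_cast hj
    have e : 1 - (n : ℝ) / (n + 1) = 1 / ((n + 1 : ℕ) : ℝ) := by push_cast; field_simp; ring
    rw [this, measureReal_def, unitInterval.volume_Icc]
    simp only [Set.Icc.coe_one, hjr]
    rw [e, ENNReal.toReal_ofReal (by positivity)]

theorem abs_sub_le_of_intervalIndex_eq {n : ℕ} {x y : unitInterval}
    (h : intervalIndex n x = intervalIndex n y) : |(x : ℝ) - y| ≤ 1 / (n + 1) := by
  have hn : (0 : ℝ) < n + 1 := by positivity
  have key : ∀ z : unitInterval, ((intervalIndex n z : ℕ) : ℝ) / (n + 1) ≤ z ∧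
      (z : ℝ) ≤ ((intervalIndex n z : ℕ) + 1) / (n + 1) := by
    intro z
    have hz : z ∈ intervalIndex n ⁻¹' {intervalIndex n z} := rfl
    rcases (Nat.lt_succ_iff.1 (intervalIndex n z).2).lt_or_eq with hj | hj
    · rw [intervalIndex_of_lt hj] at hz
      exact ⟨hz.1, hz.2.le⟩
    · rw [intervalIndex_last hj] at hz
      refine ⟨hz, ?_⟩
      rw [hj, div_self hn.ne']
      exact z.2.2
  have hx := key x
  have hy := key y
  rw [← h, add_div] at hy
  rw [add_div] at hx
  rw [abs_le]
  constructor <;> linarith [hx.1, hx.2, hy.1, hy.2]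

theorem eventually_mem_of_intervalIndex_eq {V : Set (unitInterval × unitInterval)}
    (hV : V ∈ uniformity unitInterval) :
    ∀ᶠ n in atTop, ∀ x y, intervalIndex n x = intervalIndex n y → (x, y) ∈ V := by
  obtain ⟨ε, hε, h⟩ := Metric.mem_uniformity_dist.1 hV
  have ht := tendsto_one_div_add_atTop_nhds_zero_nat (𝕜 := ℝ)
  filter_upwards [ht.eventually (gt_mem_nhds hε)] with n hn x y hxy
  refine h ?_
  rw [Subtype.dist_eq, Real.dist_eq]
  exact (abs_sub_le_of_intervalIndex_eq hxy).trans_lt hn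

/-- The first `n` coordinates of a point of the Cantor set, numbered by `Fin (2 ^ n)`. -/
noncomputable def cantorIndex (n : ℕ) (ω : ℕ → Bool) : Fin (2 ^ n) :=
  Fintype.equivFinOfCardEq (α := Fin n → Bool) (by simp) fun i : Fin n => ω i

theorem cantorIndex_eq_iff {n : ℕ} {ω ω' : ℕ → Bool} :
    cantorIndex n ω = cantorIndex n ω' ↔ ∀ i < n, ω i = ω' i := by
  simp only [cantorIndex, EmbeddingLike.apply_eq_iff_eq, funext_iff]
  exact ⟨fun h i hi => h ⟨i, hi⟩, fun h i => h i i.2⟩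

theorem measurable_cantorIndex (n : ℕ) : Measurable (cantorIndex n) :=
  (measurable_of_finite _).comp (measurable_pi_lambda _ fun _ => measurable_pi_apply _)

instance : IsProbabilityMeasure cantorMeasure := by
  unfold cantorMeasure; infer_instance

theorem cantorMeasure_cantorIndex (n : ℕ) (j : Fin (2 ^ n)) :
    cantorMeasure.real (cantorIndex n ⁻¹' {j}) = 1 / ((2 ^ n : ℕ) : ℝ) := by
  obtain ⟨ω, rfl⟩ : ∃ ω, cantorIndex n ω = j := by
    refine ⟨fun i => if h : i < n then (Fintype.equivFinOfCardEq (α := Fin n → Bool)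
      (by simp)).symm j ⟨i, h⟩ else false, ?_⟩
    simp [cantorIndex]
  have h : cantorIndex n ⁻¹' {cantorIndex n ω}
      = (Finset.range n : Set ℕ).pi fun i => {ω i} := by
    ext ω'
    simp [cantorIndex_eq_iff, Set.mem_pi]
  rw [h, measureReal_def, cantorMeasure,
    Measure.infinitePi_pi _ fun i _ => measurableSet_singleton _]
  simp

theorem eventually_mem_of_cantorIndex_eq {V : Set ((ℕ → Bool) × (ℕ → Bool))}
    (hV : V ∈ uniformity (ℕ → Bool)) :
    ∀ᶠ n in atTop, ∀ ω ω', cantorIndex n ω = cantorIndex n ω' → (ω, ω') ∈ V := by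
  rw [Pi.uniformity, Filter.mem_iInf] at hV
  obtain ⟨I, hI, W, hW, rfl⟩ := hV
  obtain ⟨m, hm⟩ := hI.bddAbove
  filter_upwards [eventually_gt_atTop m] with n hn ω ω' h
  rw [cantorIndex_eq_iff] at h
  refine Set.mem_iInter.2 fun i => ?_
  obtain ⟨t, ht, htW⟩ := hW i
  refine htW ?_
  have : ω i = ω' i := h i ((hm i.2).trans_lt hn)
  simpa [this] using refl_mem_uniformity ht

/-! ### A quasirandom symmetric kernel on the affine plane over a prime field -/

/-- The symmetric kernel `(u, v), (s, t) ↦ u s + v + t` on `(ℤ / p)²`. If `b` and `b'` have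
different first coordinates, the values `(planeKernel a b, planeKernel a b')` run through all pairs
exactly once as `a` varies. -/
def planeKernel {p : ℕ} (a b : ZMod p × ZMod p) : ZMod p := a.1 * b.1 + a.2 + b.2

theorem planeKernel_comm {p : ℕ} (a b : ZMod p × ZMod p) : planeKernel a b = planeKernel b a := by
  unfold planeKernel; ring

/-- The indicator function of the residues with representative in `[0, c p)`, a set of density
approximately `c`. -/
noncomputable def densityIndicator (p : ℕ) (c : ℝ) (s : ZMod p) : ℝ :=
  open Classical in if (s.val : ℝ) < c * p then 1 else 0

theorem densityIndicator_mem {p : ℕ} (c : ℝ) (s : ZMod p) :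
    0 ≤ densityIndicator p c s ∧ densityIndicator p c s ≤ 1 := by
  unfold densityIndicator; split_ifs <;> simp

section Kernel

variable {p : ℕ} [Fact p.Prime]

theorem sum_planeKernel_mul_planeKernel {F : ZMod p → ℝ} (hF : ∑ s, F s = 0)
    {b b' : ZMod p × ZMod p} (h : b.1 ≠ b'.1) :
    ∑ a, F (planeKernel a b) * F (planeKernel a b') = 0 := by
  have hinj : Function.Injective fun a : ZMod p × ZMod p => (planeKernel a b, planeKernel a b') := by
    intro a a' haa
    simp only [planeKernel, Prod.mk.injEq] at haa
    obtain ⟨h1, h2⟩ := haa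
    have h3 : (a.1 - a'.1) * (b.1 - b'.1) = 0 := by linear_combination h1 - h2
    have h4 : a.1 = a'.1 := by
      rcases mul_eq_zero.1 h3 with h4 | h4
      · exact sub_eq_zero.1 h4
      · exact absurd (sub_eq_zero.1 h4) h
    refine Prod.ext h4 ?_
    rw [h4] at h1
    linear_combination h1
  have hbij := Finite.injective_iff_bijective.1 hinj
  rw [Fintype.sum_bijective _ hbij _ (fun q : ZMod p × ZMod p => F q.1 * F q.2) fun a => rfl,
    Fintype.sum_prod_type]
  simp only [← Finset.mul_sum, hF, mul_zero, Finset.sum_const_zero]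

/-- The cut-norm bound for functions of `planeKernel`: by Cauchy–Schwarz, it suffices that most of
the codegree sums vanish. -/
theorem sq_sum_planeKernel_le {F : ZMod p → ℝ} (hF : ∑ s, F s = 0) (hF1 : ∀ s, |F s| ≤ 1)
    {f g : ZMod p × ZMod p → ℝ} (hf : ∀ a, |f a| ≤ 1) (hg : ∀ a, |g a| ≤ 1) :
    (∑ a, ∑ b, f a * g b * F (planeKernel a b)) ^ 2 ≤ (p : ℝ) ^ 7 := by
  have hcard : (Fintype.card (ZMod p × ZMod p) : ℝ) = (p : ℝ) ^ 2 := by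
    rw [Fintype.card_prod, ZMod.card]; push_cast; ring
  have hC : ∀ b b' : ZMod p × ZMod p,
      g b * g b' * ∑ a, F (planeKernel a b) * F (planeKernel a b')
        ≤ if b.1 = b'.1 then (p : ℝ) ^ 2 else 0 := by
    intro b b'
    split_ifs with h
    · refine (le_abs_self _).trans ?_
      rw [abs_mul, abs_mul]
      have h1 : |∑ a, F (planeKernel a b) * F (planeKernel a b')| ≤ (p : ℝ) ^ 2 := by
        refine (Finset.abs_sum_le_sum_abs _ _).trans ?_
        calc ∑ a, |F (planeKernel a b) * F (planeKernel a b')|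
            ≤ ∑ _a : ZMod p × ZMod p, (1 : ℝ) := Finset.sum_le_sum fun a _ => by
              rw [abs_mul]; exact mul_le_one₀ (hF1 _) (abs_nonneg _) (hF1 _)
          _ = (p : ℝ) ^ 2 := by rw [Finset.sum_const, Finset.card_univ, nsmul_eq_mul, hcard, mul_one]
      calc |g b| * |g b'| * |∑ a, F (planeKernel a b) * F (planeKernel a b')|
          ≤ 1 * |∑ a, F (planeKernel a b) * F (planeKernel a b')| := by
            gcongr; exact mul_le_one₀ (hg _) (abs_nonneg _) (hg _)
        _ ≤ _ := by rw [one_mul]; exact h1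
    · rw [sum_planeKernel_mul_planeKernel hF h, mul_zero]
  have hH : ∑ a, (∑ b, g b * F (planeKernel a b)) ^ 2 ≤ (p : ℝ) ^ 5 := by
    calc ∑ a, (∑ b, g b * F (planeKernel a b)) ^ 2
        = ∑ b, ∑ b', g b * g b' * ∑ a, F (planeKernel a b) * F (planeKernel a b') := by
          have hsq : ∀ a, (∑ b, g b * F (planeKernel a b)) ^ 2 = ∑ b, ∑ b',
              g b * F (planeKernel a b) * (g b' * F (planeKernel a b')) := fun a => by
            rw [sq, Finset.sum_mul_sum]
          simp only [hsq, Finset.mul_sum]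
          rw [Finset.sum_comm]
          refine Finset.sum_congr rfl fun b _ => ?_
          rw [Finset.sum_comm]
          exact Finset.sum_congr rfl fun b' _ => Finset.sum_congr rfl fun a _ => by ring
      _ ≤ ∑ b : ZMod p × ZMod p, ∑ b' : ZMod p × ZMod p,
            (if b.1 = b'.1 then (p : ℝ) ^ 2 else 0) :=
          Finset.sum_le_sum fun b _ => Finset.sum_le_sum fun b' _ => hC b b'
      _ = ∑ s : ZMod p, ∑ _t : ZMod p, ∑ s' : ZMod p, ∑ _t' : ZMod p,
            (if s = s' then (p : ℝ) ^ 2 else 0) := by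
          simp only [Fintype.sum_prod_type]
      _ = (p : ℝ) ^ 5 := by
          simp only [Finset.sum_const, Finset.card_univ, ZMod.card,
            nsmul_eq_mul, mul_ite, mul_zero, Finset.sum_ite_eq,
            Finset.mem_univ, if_true]
          ring
  calc (∑ a, ∑ b, f a * g b * F (planeKernel a b)) ^ 2
      = (∑ a, f a * ∑ b, g b * F (planeKernel a b)) ^ 2 := by
        simp only [Finset.mul_sum, mul_assoc]
    _ ≤ (∑ a, f a ^ 2) * ∑ a, (∑ b, g b * F (planeKernel a b)) ^ 2 :=
        Finset.sum_mul_sq_le_sq_mul_sq _ _ _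
    _ ≤ (p : ℝ) ^ 2 * (p : ℝ) ^ 5 := by
        refine mul_le_mul ?_ hH (Finset.sum_nonneg fun a _ => sq_nonneg _) (by positivity)
        calc ∑ a, f a ^ 2 ≤ ∑ _a : ZMod p × ZMod p, (1 : ℝ) :=
              Finset.sum_le_sum fun a _ => (sq_le_one_iff_abs_le_one _).2 (hf a)
          _ = (p : ℝ) ^ 2 := by rw [Finset.sum_const, Finset.card_univ, nsmul_eq_mul, hcard, mul_one]
    _ = (p : ℝ) ^ 7 := by ring

theorem sum_densityIndicator {c : ℝ} (h1 : c ≤ 1) :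
    ∑ s, densityIndicator p c s = ⌈c * p⌉₊ := by
  classical
  have hp : 0 < p := (Fact.out : p.Prime).pos
  have hle : ⌈c * p⌉₊ ≤ p := Nat.ceil_le.2 (mul_le_of_le_one_left (Nat.cast_nonneg p) h1)
  have himg : (Finset.univ.filter fun s : ZMod p => (s.val : ℝ) < c * p).image ZMod.val
      = Finset.range ⌈c * p⌉₊ := by
    ext m
    simp only [Finset.mem_image, Finset.mem_filter, Finset.mem_univ, true_and, Finset.mem_range,
      Nat.lt_ceil]
    constructor
    · rintro ⟨s, hs, rfl⟩; exact hs
    · intro hm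
      have hmp : m < p := (Nat.lt_ceil.2 hm).trans_le hle
      exact ⟨m, by rwa [ZMod.val_cast_of_lt hmp], ZMod.val_cast_of_lt hmp⟩
  have hcard := congrArg Finset.card himg
  rw [Finset.card_image_of_injective _ (ZMod.val_injective p), Finset.card_range] at hcard
  simp only [densityIndicator]
  rw [← hcard, Finset.sum_boole]

/-- A kernel `densityIndicator p c ∘ planeKernel` is close to the constant `c` in cut norm. -/
theorem abs_sum_densityIndicator_sub_le {c : ℝ} (h0 : 0 ≤ c) (h1 : c ≤ 1)
    {f g : ZMod p × ZMod p → ℝ} (hf : ∀ a, |f a| ≤ 1) (hg : ∀ a, |g a| ≤ 1) :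
    |∑ a, ∑ b, f a * g b * (densityIndicator p c (planeKernel a b) - c)|
      ≤ √((p : ℝ) ^ 7) + (p : ℝ) ^ 3 := by
  have hp : (0 : ℝ) < p := by exact_mod_cast (Fact.out : p.Prime).pos
  -- The exact density of the indicator function, which is within `1 / p` of `c`.
  set d : ℝ := ⌈c * p⌉₊ / p with hd
  have hcp : 0 ≤ c * p := by positivity
  have hdc : |d - c| ≤ 1 / p := by
    have e1 := Nat.le_ceil (c * p)
    have e2 := Nat.ceil_lt_add_one hcp
    have : d - c = (⌈c * p⌉₊ - c * p) / p := by rw [hd]; field_simp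
    rw [this, abs_div, abs_of_pos hp]
    gcongr
    rw [abs_le]; constructor <;> linarith
  have hd0 : 0 ≤ d := by positivity
  have hd1 : d ≤ 1 := by
    rw [hd, div_le_one hp]
    exact_mod_cast Nat.ceil_le.2 (mul_le_of_le_one_left hp.le h1)
  have hF : ∑ s, (densityIndicator p c s - d) = 0 := by
    rw [Finset.sum_sub_distrib, sum_densityIndicator h1, Finset.sum_const, Finset.card_univ,
      ZMod.card, nsmul_eq_mul, hd]
    field_simp
    ring
  have hF1 : ∀ s, |densityIndicator p c s - d| ≤ 1 := fun s => by
    have := densityIndicator_mem c s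
    rw [abs_le]; constructor <;> linarith [this.1, this.2]
  have key := Real.abs_le_sqrt (sq_sum_planeKernel_le hF hF1 hf hg)
  have hcard : (Fintype.card (ZMod p × ZMod p) : ℝ) = (p : ℝ) ^ 2 := by
    rw [Fintype.card_prod, ZMod.card]; push_cast; ring
  have hconst : |∑ a, ∑ b, f a * g b * (d - c)| ≤ (p : ℝ) ^ 3 := by
    calc |∑ a, ∑ b, f a * g b * (d - c)| ≤ ∑ a, ∑ b, |f a * g b * (d - c)| :=
          (Finset.abs_sum_le_sum_abs _ _).trans
            (Finset.sum_le_sum fun a _ => Finset.abs_sum_le_sum_abs _ _)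
      _ ≤ ∑ _a : ZMod p × ZMod p, ∑ _b : ZMod p × ZMod p, 1 / (p : ℝ) :=
          Finset.sum_le_sum fun a _ => Finset.sum_le_sum fun b _ => by
            rw [abs_mul, abs_mul]
            calc |f a| * |g b| * |d - c| ≤ 1 * |d - c| := by
                  gcongr; exact mul_le_one₀ (hf _) (abs_nonneg _) (hg _)
              _ ≤ 1 / p := by rw [one_mul]; exact hdc
      _ = (p : ℝ) ^ 3 := by
          rw [Finset.sum_const, Finset.sum_const, Finset.card_univ, nsmul_eq_mul, nsmul_eq_mul,
            hcard]
          field_simp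
  calc |∑ a, ∑ b, f a * g b * (densityIndicator p c (planeKernel a b) - c)|
      = |∑ a, ∑ b, f a * g b * (densityIndicator p c (planeKernel a b) - d)
          + ∑ a, ∑ b, f a * g b * (d - c)| := by
        simp only [← Finset.sum_add_distrib]
        congr 1
        exact Finset.sum_congr rfl fun a _ => Finset.sum_congr rfl fun b _ => by ring
    _ ≤ _ := (abs_add_le _ _).trans (add_le_add key hconst)

end Kernel

/-! ### Quasirandom graphs with prescribed block densities -/

/-- The graph on `N` blocks of size `p²` in which the bipartite graph between the blocks `x` and `y`
is quasirandom of density about `S(x, y)`. -/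
def quasirandomGraph {N : ℕ} (S : Matrix (Fin N) (Fin N) ℝ) (hS : S.IsSymm) (p : ℕ) :
    SimpleGraph (Fin N × ZMod p × ZMod p) where
  Adj v w := v ≠ w ∧ ((planeKernel v.2 w.2).val : ℝ) < S v.1 w.1 * p
  symm := ⟨fun v w h => ⟨h.1.symm, by rw [planeKernel_comm, hS.apply]; exact h.2⟩⟩
  loopless := ⟨fun v h => h.1 rfl⟩

section Graph

variable {N : ℕ} {S : Matrix (Fin N) (Fin N) ℝ} {p : ℕ} [Fact p.Prime]

open Classical in
theorem adjMatrix_quasirandomGraph (hS : S.IsSymm) (v w : Fin N × ZMod p × ZMod p) :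
    (quasirandomGraph S hS p).adjMatrix ℝ v w
      = densityIndicator p (S v.1 w.1) (planeKernel v.2 w.2)
        - if v = w then densityIndicator p (S v.1 w.1) (planeKernel v.2 w.2) else 0 := by
  by_cases h : v = w <;> simp [SimpleGraph.adjMatrix_apply, quasirandomGraph, densityIndicator, h]

open Classical in
/-- The adjacency matrix is close in cut norm to the block matrix with entries `S(x, y)`. -/
theorem abs_sum_adjMatrix_sub_le (hS : S.IsSymm) (h0 : ∀ x y, 0 ≤ S x y) (h1 : ∀ x y, S x y ≤ 1)
    {f g : Fin N × ZMod p × ZMod p → ℝ} (hf : ∀ v, |f v| ≤ 1) (hg : ∀ v, |g v| ≤ 1) :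
    |∑ v, ∑ w, f v * g w * ((quasirandomGraph S hS p).adjMatrix ℝ v w - S v.1 w.1)|
      ≤ 3 * (N : ℝ) ^ 2 * √((p : ℝ) ^ 7) := by
  have hp1 : (1 : ℝ) ≤ p := by exact_mod_cast (Fact.out : p.Prime).one_le
  set B := √((p : ℝ) ^ 7)
  have hpow : ∀ j ≤ 3, (p : ℝ) ^ j ≤ B := fun j hj => by
    refine Real.le_sqrt_of_sq_le ?_
    rw [← pow_mul]
    exact pow_le_pow_right₀ hp1 (by omega)
  set I : Fin N × ZMod p × ZMod p → Fin N × ZMod p × ZMod p → ℝ :=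
    fun v w => densityIndicator p (S v.1 w.1) (planeKernel v.2 w.2) with hI
  -- `I` is the adjacency matrix with loops left in; the diagonal is negligible.
  have hmain : |∑ v, ∑ w, f v * g w * (I v w - S v.1 w.1)| ≤ (N : ℝ) ^ 2 * (B + (p : ℝ) ^ 3) := by
    have e : ∑ v, ∑ w, f v * g w * (I v w - S v.1 w.1)
        = ∑ x, ∑ y, ∑ a, ∑ b, f (x, a) * g (y, b)
            * (densityIndicator p (S x y) (planeKernel a b) - S x y) := by
      rw [Fintype.sum_prod_type]
      refine Finset.sum_congr rfl fun x _ => ?_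
      rw [Finset.sum_comm]
      rw [Fintype.sum_prod_type]
      exact Finset.sum_congr rfl fun y _ => Finset.sum_comm
    rw [e]
    calc _ ≤ ∑ x, ∑ y, |∑ a, ∑ b, f (x, a) * g (y, b)
            * (densityIndicator p (S x y) (planeKernel a b) - S x y)| :=
          (Finset.abs_sum_le_sum_abs _ _).trans
            (Finset.sum_le_sum fun a _ => Finset.abs_sum_le_sum_abs _ _)
      _ ≤ ∑ _x : Fin N, ∑ _y : Fin N, (B + (p : ℝ) ^ 3) :=
          Finset.sum_le_sum fun x _ => Finset.sum_le_sum fun y _ =>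
            abs_sum_densityIndicator_sub_le (h0 x y) (h1 x y) (fun a => hf _) (fun b => hg _)
      _ = _ := by
          simp only [Finset.sum_const, Finset.card_univ, Fintype.card_fin, nsmul_eq_mul]; ring
  have hdiag : |∑ v, f v * g v * I v v| ≤ N * (p : ℝ) ^ 2 := by
    calc |∑ v, f v * g v * I v v| ≤ ∑ v, |f v * g v * I v v| := Finset.abs_sum_le_sum_abs _ _
      _ ≤ ∑ _v : Fin N × ZMod p × ZMod p, (1 : ℝ) := Finset.sum_le_sum fun v _ => by
          have := densityIndicator_mem (p := p) (S v.1 v.1) (planeKernel v.2 v.2)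
          rw [abs_mul, abs_mul, abs_of_nonneg this.1]
          exact mul_le_one₀ (mul_le_one₀ (hf _) (abs_nonneg _) (hg _)) this.1 this.2
      _ = N * (p : ℝ) ^ 2 := by
          rw [Finset.sum_const, Finset.card_univ, Fintype.card_prod, Fintype.card_prod, ZMod.card,
            Fintype.card_fin, nsmul_eq_mul]
          push_cast; ring
  have hsplit : ∑ v, ∑ w, f v * g w * ((quasirandomGraph S hS p).adjMatrix ℝ v w - S v.1 w.1)
      = ∑ v, ∑ w, f v * g w * (I v w - S v.1 w.1) - ∑ v, f v * g v * I v v := by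
    rw [← Finset.sum_sub_distrib]
    refine Finset.sum_congr rfl fun v _ => ?_
    have e : f v * g v * I v v = ∑ w, f v * g w * (if v = w then I v w else 0) := by
      simp
    rw [e, ← Finset.sum_sub_distrib]
    refine Finset.sum_congr rfl fun w _ => ?_
    rw [adjMatrix_quasirandomGraph]
    ring
  have hN : (N : ℝ) ≤ (N : ℝ) ^ 2 := by exact_mod_cast Nat.le_self_pow two_ne_zero N
  rw [hsplit]
  calc _ ≤ (N : ℝ) ^ 2 * (B + (p : ℝ) ^ 3) + N * (p : ℝ) ^ 2 :=
        (abs_sub _ _).trans (add_le_add hmain hdiag)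
    _ ≤ (N : ℝ) ^ 2 * (B + B) + (N : ℝ) ^ 2 * B := by
        gcongr
        · exact hpow 3 le_rfl
        · exact hpow 2 (by norm_num)
    _ = _ := by ring

end Graph

/-! ### Shapes of quasirandom graphs -/

theorem mul_mul_transpose_apply {V : Type} [Fintype V] {k : ℕ} (M : Matrix (Fin k) V ℝ)
    (S : Matrix V V ℝ) (i j : Fin k) :
    (M * S * M.transpose) i j = ∑ v, ∑ w, M i v * M j w * S v w := by
  simp only [Matrix.mul_apply, Matrix.transpose_apply, Finset.sum_mul]
  rw [Finset.sum_comm]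
  exact Finset.sum_congr rfl fun x _ => Finset.sum_congr rfl fun y _ => by ring

theorem matrixShape_submatrix {V W : Type} [Fintype V] [Fintype W] (φ : W ≃ V) (S : Matrix V V ℝ)
    (k : ℕ) : matrixShape (S.submatrix φ φ) k = matrixShape S k := by
  have key : ∀ {V W : Type} [Fintype V] [Fintype W] (φ : W ≃ V) (S : Matrix V V ℝ),
      matrixShape S k ⊆ matrixShape (S.submatrix φ φ) k := by
    rintro V W _ _ φ S _ ⟨M, ⟨h0, hr, hc⟩, rfl⟩
    refine ⟨M.submatrix id φ, ⟨fun i x => h0 _ _, fun i => ?_, fun x => hc _⟩, ?_⟩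
    · rw [Fintype.card_congr φ, ← hr i]
      exact Equiv.sum_comp φ (fun x => M i x)
    · rw [Matrix.submatrix_mul_equiv, Matrix.transpose_submatrix, Matrix.submatrix_mul_equiv,
        Matrix.submatrix_id_id]
  refine subset_antisymm ?_ (key φ S)
  have := key φ.symm (S.submatrix φ φ)
  simpa using this

theorem l1Norm_submatrix {V W : Type} [Fintype V] [Fintype W] (φ : W ≃ V) (S : Matrix V V ℝ) :
    l1Norm (S.submatrix φ φ) = l1Norm S := by
  unfold l1Norm
  rw [← Equiv.sum_comp φ]
  exact Finset.sum_congr rfl fun x _ => Equiv.sum_comp φ (fun y => |S (φ x) y|)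

theorem graphShape_comap {V W : Type} [Fintype V] [Fintype W] (φ : W ≃ V) (G : SimpleGraph V)
    (k : ℕ) : graphShape (G.comap φ) k = graphShape G k := by
  classical
  have h : ∀ [DecidableRel (G.comap φ).Adj],
      (G.comap φ).adjMatrix ℝ = (G.adjMatrix ℝ).submatrix φ φ := by
    intro _
    ext x y
    simp [SimpleGraph.adjMatrix_apply]
  simp only [graphShape, h]
  convert congrArg₂ (fun (c : ℝ) s => (fun X => c⁻¹ • X) '' s)
    (l1Norm_submatrix φ (G.adjMatrix ℝ)) (matrixShape_submatrix φ (G.adjMatrix ℝ) k)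

section Blowup

variable {N k : ℕ} {B : Type} [Fintype B] [Nonempty B]

/-- The matrix on `Fin N` obtained from one on `Fin N × B` by averaging over the blocks. -/
noncomputable def blockAverage (M : Matrix (Fin k) (Fin N × B) ℝ) : Matrix (Fin k) (Fin N) ℝ :=
  Matrix.of fun i x => (∑ b, M i (x, b)) / Fintype.card B

theorem blockAverage_mem {M : Matrix (Fin k) (Fin N × B) ℝ}
    (hM : M ∈ fractionalPartitions k (Fin N × B)) :
    blockAverage M ∈ fractionalPartitions k (Fin N) := by
  obtain ⟨h0, hr, hc⟩ := hM
  have hB : (Fintype.card B : ℝ) ≠ 0 := by exact_mod_cast Fintype.card_ne_zero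
  refine ⟨fun i x => div_nonneg (Finset.sum_nonneg fun b _ => h0 _ _) (Nat.cast_nonneg _),
    fun i => ?_, fun x => ?_⟩
  · simp only [blockAverage, Matrix.of_apply]
    rw [← Finset.sum_div, ← Fintype.sum_prod_type (f := fun v => M i v), hr, Fintype.card_prod]
    push_cast
    field_simp
  · simp only [blockAverage, Matrix.of_apply]
    rw [← Finset.sum_div, Finset.sum_comm]
    simp [hc, hB]

theorem exists_blockAverage_eq {M : Matrix (Fin k) (Fin N) ℝ}
    (hM : M ∈ fractionalPartitions k (Fin N)) :
    ∃ M' ∈ fractionalPartitions k (Fin N × B), blockAverage M' = M := by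
  obtain ⟨h0, hr, hc⟩ := hM
  have hB : (Fintype.card B : ℝ) ≠ 0 := by exact_mod_cast Fintype.card_ne_zero
  refine ⟨Matrix.of fun i v => M i v.1, ⟨fun i v => h0 _ _, fun i => ?_, fun v => hc _⟩, ?_⟩
  · simp only [Matrix.of_apply, Fintype.sum_prod_type, Finset.sum_const, Finset.card_univ,
      nsmul_eq_mul, ← Finset.mul_sum, hr, Fintype.card_prod]
    push_cast
    ring
  · ext i x
    simp [blockAverage, hB]

theorem blockAverage_mul_mul_apply (M : Matrix (Fin k) (Fin N × B) ℝ)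
    (S : Matrix (Fin N) (Fin N) ℝ) (i j : Fin k) :
    (blockAverage M * S * (blockAverage M).transpose) i j
      = (∑ v, ∑ w, M i v * M j w * S v.1 w.1) / (Fintype.card B : ℝ) ^ 2 := by
  have hB : (Fintype.card B : ℝ) ≠ 0 := by exact_mod_cast Fintype.card_ne_zero
  have e : ∑ v, ∑ w, M i v * M j w * S v.1 w.1
      = ∑ x, ∑ y, (∑ a, M i (x, a)) * (∑ b, M j (y, b)) * S x y := by
    rw [Fintype.sum_prod_type]
    refine Finset.sum_congr rfl fun x _ => ?_
    rw [Finset.sum_comm, Fintype.sum_prod_type]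
    refine Finset.sum_congr rfl fun y _ => ?_
    rw [Finset.sum_comm, Finset.sum_mul_sum, Finset.sum_mul]
    exact Finset.sum_congr rfl fun a _ => by rw [Finset.sum_mul]
  rw [mul_mul_transpose_apply, e, Finset.sum_div]
  refine Finset.sum_congr rfl fun x _ => ?_
  rw [Finset.sum_div]
  refine Finset.sum_congr rfl fun y _ => ?_
  simp only [blockAverage, Matrix.of_apply]
  field_simp

open Classical in
/-- If the adjacency matrix of `G` is close in cut norm to the blow-up of a matrix `S` of entry sum
`1`, then the shapes of `G` are close to those of `S`. -/
theorem hausdorffEDist_graphShape_le {S : Matrix (Fin N) (Fin N) ℝ} (hsum : entrySum S = 1)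
    (G : SimpleGraph (Fin N × B)) {ε : ℝ} (hε1 : ε < 1)
    (hcut : ∀ f g : Fin N × B → ℝ, (∀ v, |f v| ≤ 1) → (∀ v, |g v| ≤ 1) →
      |∑ v, ∑ w, f v * g w * (G.adjMatrix ℝ v w - S v.1 w.1)| ≤ ε * (Fintype.card B : ℝ) ^ 2) :
    G.edgeSet.Nonempty ∧ ∀ k : ℕ,
      Metric.hausdorffEDist (toL1 '' graphShape G k) (toL1 '' matrixShape S k)
        ≤ ENNReal.ofReal ((k : ℝ) ^ 2 * (2 * ε)) := by
  set A := G.adjMatrix ℝ with hA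
  have hB : (0 : ℝ) < Fintype.card B := by exact_mod_cast Fintype.card_pos
  set q := (Fintype.card B : ℝ) ^ 2 with hq
  have hq0 : 0 < q := by positivity
  have hA0 : ∀ v w, 0 ≤ A v w := fun v w => by
    rw [hA, SimpleGraph.adjMatrix_apply]; split_ifs <;> simp
  set γ := l1Norm A with hγ
  have hγA : γ = ∑ v, ∑ w, A v w :=
    Finset.sum_congr rfl fun v _ => Finset.sum_congr rfl fun w _ => abs_of_nonneg (hA0 v w)
  have hSq : ∑ v : Fin N × B, ∑ w : Fin N × B, S v.1 w.1 = q := by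
    simp only [Fintype.sum_prod_type, Finset.sum_const, Finset.card_univ, nsmul_eq_mul,
      ← Finset.mul_sum]
    have : ∑ x, ∑ y, S x y = 1 := hsum
    rw [this, hq]; ring
  -- The constant test functions control the number of edges.
  have hγq : |γ - q| ≤ ε * q := by
    have := hcut (fun _ => 1) (fun _ => 1) (by simp) (by simp)
    simp only [one_mul, Finset.sum_sub_distrib] at this
    rwa [← hγA, hSq] at this
  have hγ0 : 0 < γ := by
    have := (abs_le.1 hγq).1
    nlinarith
  refine ⟨?_, fun k => ?_⟩
  · by_contra hne
    have hbot : G = ⊥ := SimpleGraph.edgeSet_eq_empty.1 (Set.not_nonempty_iff_eq_empty.1 hne)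
    refine hγ0.ne' (hγA.trans (Finset.sum_eq_zero fun v _ => Finset.sum_eq_zero fun w _ => ?_))
    rw [hA, SimpleGraph.adjMatrix_apply, hbot]
    simp
  have hclose : ∀ M ∈ fractionalPartitions k (Fin N × B), ∀ i j,
      |(γ⁻¹ • (M * A * M.transpose)) i j
        - (blockAverage M * S * (blockAverage M).transpose) i j| ≤ 2 * ε := by
    rintro M ⟨h0, -, hc⟩ i j
    have h1 : ∀ i v, M i v ≤ 1 := fun i v => le_one_of_sum_eq_one (fun i => h0 i v) (hc v) i
    have habs : ∀ i v, |M i v| ≤ 1 := fun i v => by rw [abs_of_nonneg (h0 i v)]; exact h1 i v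
    rw [blockAverage_mul_mul_apply, Matrix.smul_apply, mul_mul_transpose_apply, smul_eq_mul]
    set X := ∑ v, ∑ w, M i v * M j w * A v w with hX
    set Y := ∑ v, ∑ w, M i v * M j w * S v.1 w.1 with hY
    have hXY : |X - Y| ≤ ε * q := by
      have := hcut (M i) (M j) (habs i) (habs j)
      simp only [mul_sub, Finset.sum_sub_distrib] at this
      exact this
    have hX0 : 0 ≤ X := Finset.sum_nonneg fun v _ => Finset.sum_nonneg fun w _ =>
      mul_nonneg (mul_nonneg (h0 _ _) (h0 _ _)) (hA0 _ _)
    have hXγ : X ≤ γ := by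
      rw [hγA]
      exact Finset.sum_le_sum fun v _ => Finset.sum_le_sum fun w _ =>
        mul_le_of_le_one_left (hA0 _ _) (mul_le_one₀ (h1 _ _) (h0 _ _) (h1 _ _))
    have e : γ⁻¹ * X - Y / q = (X / γ) * ((q - γ) / q) + (X - Y) / q := by
      field_simp; ring
    have hXγ1 : |X / γ| ≤ 1 := by
      rw [abs_of_nonneg (by positivity), div_le_one hγ0]; exact hXγ
    have t1 : |(q - γ) / q| ≤ ε := by
      rw [abs_div, abs_of_pos hq0, div_le_iff₀ hq0, abs_sub_comm]; exact hγq
    have t2 : |(X - Y) / q| ≤ ε := by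
      rw [abs_div, abs_of_pos hq0, div_le_iff₀ hq0]; exact hXY
    rw [e]
    calc |X / γ * ((q - γ) / q) + (X - Y) / q|
        ≤ |X / γ * ((q - γ) / q)| + |(X - Y) / q| := abs_add_le _ _
      _ ≤ ε + ε := by
        refine add_le_add ?_ t2
        rw [abs_mul]
        exact (mul_le_of_le_one_left (abs_nonneg _) hXγ1).trans t1
      _ = 2 * ε := by ring
  refine Metric.hausdorffEDist_le_of_mem_edist ?_ ?_
  · rintro _ ⟨_, ⟨_, ⟨M, hM, rfl⟩, rfl⟩, rfl⟩
    exact ⟨_, ⟨_, ⟨_, blockAverage_mem hM, rfl⟩, rfl⟩, edist_toL1_le (hclose M hM)⟩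
  · rintro _ ⟨_, ⟨M, hM, rfl⟩, rfl⟩
    obtain ⟨M', hM', rfl⟩ := exists_blockAverage_eq (B := B) hM
    refine ⟨_, ⟨_, ⟨_, ⟨M', hM', rfl⟩, rfl⟩, rfl⟩, ?_⟩
    rw [edist_comm]
    exact edist_toL1_le (hclose M' hM')

end Blowup

/-- A single graph approximates all the shapes of a symmetric nonnegative matrix of entry sum `1`. -/
theorem exists_graph_near {N : ℕ} {S : Matrix (Fin N) (Fin N) ℝ} (hS : S.IsSymm)
    (h0 : ∀ x y, 0 ≤ S x y) (hsum : entrySum S = 1) {ε : ℝ} (hε : 0 < ε) :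
    ∃ (n : ℕ) (G : SimpleGraph (Fin n)), G.edgeSet.Nonempty ∧ ∀ k : ℕ,
      Metric.hausdorffEDist (toL1 '' graphShape G k) (toL1 '' matrixShape S k)
        ≤ ENNReal.ofReal ((k : ℝ) ^ 2 * ε) := by
  have h1 : ∀ x y, S x y ≤ 1 := fun x y => by
    rw [← hsum]
    exact (Finset.single_le_sum (f := fun y => S x y) (fun y _ => h0 x y) (Finset.mem_univ y)).trans
      (Finset.single_le_sum (f := fun x => ∑ y, S x y)
        (fun x _ => Finset.sum_nonneg fun y _ => h0 x y) (Finset.mem_univ x))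
  set η := min (ε / 2) (1 / 2) with hη
  have hη0 : 0 < η := by positivity
  -- A prime with `3 N² √(p⁷) ≤ η p⁴`.
  obtain ⟨p, hp, hprime⟩ := Nat.exists_infinite_primes ⌈(3 * (N : ℝ) ^ 2 / η) ^ 2⌉₊
  have : Fact p.Prime := ⟨hprime⟩
  have hp0 : (0 : ℝ) < p := by exact_mod_cast hprime.pos
  have hsqrt : 3 * (N : ℝ) ^ 2 / η ≤ √p :=
    Real.le_sqrt_of_sq_le ((Nat.le_ceil _).trans (by exact_mod_cast hp))
  have hbound : 3 * (N : ℝ) ^ 2 * √((p : ℝ) ^ 7)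
      ≤ η * (Fintype.card (ZMod p × ZMod p) : ℝ) ^ 2 := by
    have e1 : √((p : ℝ) ^ 7) = (p : ℝ) ^ 3 * √p := by
      rw [show (p : ℝ) ^ 7 = ((p : ℝ) ^ 3) ^ 2 * p by ring, Real.sqrt_mul (by positivity),
        Real.sqrt_sq (by positivity)]
    have e2 : (Fintype.card (ZMod p × ZMod p) : ℝ) ^ 2 = (p : ℝ) ^ 3 * (√p * √p) := by
      rw [Real.mul_self_sqrt hp0.le, Fintype.card_prod, ZMod.card]; push_cast; ring
    rw [div_le_iff₀ hη0] at hsqrt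
    rw [e1, e2]
    calc 3 * (N : ℝ) ^ 2 * ((p : ℝ) ^ 3 * √p) ≤ √p * η * ((p : ℝ) ^ 3 * √p) := by gcongr
      _ = _ := by ring
  obtain ⟨hne, hdist⟩ := hausdorffEDist_graphShape_le (ε := η) hsum (quasirandomGraph S hS p)
    ((min_le_right _ _).trans_lt (by norm_num))
    fun f g hf hg => (abs_sum_adjMatrix_sub_le hS h0 h1 hf hg).trans hbound
  set φ := (Fintype.equivFin (Fin N × ZMod p × ZMod p)).symm
  refine ⟨_, (quasirandomGraph S hS p).comap φ, ?_, fun k => ?_⟩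
  · rw [SimpleGraph.edgeSet_nonempty] at hne ⊢
    intro hbot
    refine hne ?_
    ext v w
    have := congrArg (fun H => H.Adj (φ.symm v) (φ.symm w)) hbot
    simpa using this
  · rw [graphShape_comap]
    refine (hdist k).trans (ENNReal.ofReal_le_ofReal ?_)
    gcongr
    linarith [min_le_left (ε / 2) (1 / 2 : ℝ)]

/-- Replacing each matrix of a convergent sequence by a graph with nearly the same shapes does not
change the limit. -/
theorem exists_graphs_of_isMatrixLimit {Ω : Type} [MeasurableSpace Ω] {ν : Measure Ω}
    {μ : Measure (Ω × Ω)} {n : ℕ → ℕ} {S : ∀ i, Matrix (Fin (n i)) (Fin (n i)) ℝ}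
    (hS : ∀ i, (S i).IsSymm) (h0 : ∀ i x y, 0 ≤ S i x y) (hsum : ∀ i, entrySum (S i) = 1)
    (hlim : IsMatrixLimit ν S μ) :
    ∃ (n : ℕ → ℕ) (G : ∀ i, SimpleGraph (Fin (n i))),
      (∀ i, (G i).edgeSet.Nonempty) ∧ SConvergent G ∧ IsSLimit ν G μ := by
  choose m G hne hdist using fun i : ℕ =>
    exists_graph_near (hS i) (h0 i) (hsum i) (ε := 1 / ((i : ℝ) + 1)) (by positivity)
  have hGlim : IsSLimit ν G μ := by
    intro k hk
    have ht : Tendsto (fun i : ℕ => ENNReal.ofReal ((k : ℝ) ^ 2 * (1 / ((i : ℝ) + 1)))) atTop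
        (𝓝 0) := by
      have := (tendsto_one_div_add_atTop_nhds_zero_nat (𝕜 := ℝ)).const_mul ((k : ℝ) ^ 2)
      simpa using ENNReal.tendsto_ofReal this
    have hadd := ht.add (hlim k hk)
    rw [add_zero] at hadd
    exact tendsto_of_tendsto_of_tendsto_of_le_of_le tendsto_const_nhds hadd (fun i => zero_le)
      fun i => Metric.hausdorffEDist_triangle.trans (add_le_add (hdist i k) le_rfl)
  exact ⟨m, G, hne, fun k hk => ⟨_, isClosed_closure, hGlim k hk⟩, hGlim⟩

end ShapeLimit

theorem mainTheorem3 :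
    (∀ μ : MeasureTheory.Measure (unitInterval × unitInterval), ShapeLimit.IsSGraphon μ →
      ∃ (n : ℕ → ℕ) (G : ∀ i, SimpleGraph (Fin (n i))),
        (∀ i, (G i).edgeSet.Nonempty) ∧
        ShapeLimit.SConvergent G ∧
        ShapeLimit.IsSLimit MeasureTheory.volume G μ) ∧
    (∀ μ : MeasureTheory.Measure (unitInterval × unitInterval),
      MeasureTheory.IsFiniteMeasure μ → ShapeLimit.IsSymmetricMeasure μ →
      ∃ (n : ℕ → ℕ) (S : ∀ i, Matrix (Fin (n i)) (Fin (n i)) ℝ),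
        (∀ i, 0 < n i) ∧ (∀ i, (S i).IsSymm) ∧ (∀ i x y, 0 ≤ S i x y) ∧
        (∀ i, ShapeLimit.entrySum (S i) = μ.real Set.univ) ∧
        ShapeLimit.MatrixConvergent S ∧
        ShapeLimit.IsMatrixLimit MeasureTheory.volume S μ) ∧
    (∀ μ : MeasureTheory.Measure ((ℕ → Bool) × (ℕ → Bool)),
      MeasureTheory.IsFiniteMeasure μ → ShapeLimit.IsSymmetricMeasure μ →
      ∃ (n : ℕ → ℕ) (S : ∀ i, Matrix (Fin (n i)) (Fin (n i)) ℝ),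
        (∀ i, 0 < n i) ∧ (∀ i, (S i).IsSymm) ∧ (∀ i x y, 0 ≤ S i x y) ∧
        (∀ i, ShapeLimit.entrySum (S i) = μ.real Set.univ) ∧
        ShapeLimit.MatrixConvergent S ∧
        ShapeLimit.IsMatrixLimit ShapeLimit.cantorMeasure S μ) := by
  have hinterval := ShapeLimit.exists_matrices_of_shrinking_cells (ν := volume) (fun n => n.succ_pos)
    ShapeLimit.measurable_intervalIndex ShapeLimit.volume_intervalIndex
    fun V hV => ShapeLimit.eventually_mem_of_intervalIndex_eq hV
  refine ⟨fun μ hμ => ?_, hinterval, ShapeLimit.exists_matrices_of_shrinking_cells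
    (fun n => Nat.two_pow_pos n) ShapeLimit.measurable_cantorIndex
    ShapeLimit.cantorMeasure_cantorIndex fun V hV => ShapeLimit.eventually_mem_of_cantorIndex_eq hV⟩
  have hprob : IsProbabilityMeasure μ := hμ.1
  obtain ⟨n, S, -, hsymm, h0, hsum, -, hlim⟩ := hinterval μ inferInstance hμ.2
  exact ShapeLimit.exists_graphs_of_isMatrixLimit hsymm h0 (fun i => by rw [hsum, probReal_univ])
    hlim
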